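/- **Definitions.** A *constrained triangulation* $\mathcal T=(T,\mathcal C)$ consists of a finite oriented simplicial complex $T$ homeomorphic to a closed disk, whose boundary has exactly four vertices $\mathbf p,\mathbf q,\mathbf r,\mathbf s$ (the *corners*, labelled in the cyclic order determined by the orientation; the other vertices are *interior*), and a finite set $\mathcal C$ of *constraints*: each constraint is the set of vertices of a contiguous set of triangles of $T$ (i.e. the vertex set of a connected, nonempty subgraph of the dual graph), and the sets of triangles belonging to different constraints are pairwise disjoint. A triangle of $T$ is *living* if no constraint contains all its vertices. A *drawing* is a map $\rho:\mathrm{Vxs}(T)\to\mathbf C^2$ such that (1) for each $C\in\mathcal C$ there is a line $\ell_C$ containing $\rho(v)$ for all $v\in C$, and (2) $\rho(\mathbf p)+\rho(\mathbf r)=\rho(\mathbf q)+\rho(\mathbf s)$. It is *generic* if moreover (3) the 4-gon $(\rho(\mathbf p),\rho(\mathbf q),\rho(\mathbf r),\rho(\mathbf s))$ is non-degenerate, that is, its vertices are distinct and no three cyclically consecutive ones are collinear; (4) $\rho(x),\rho(y),\rho(z)$ are not collinear whenever $\{x,y,z\}$ is the vertex set of a living triangle; (5) $\rho$ is injective; (6)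 $\ell_C\neq\ell_{C'}$ for distinct $C,C'\in\mathcal C$ with $C\cap C'\ne\emptyset$. Let $X(\mathcal T)\subset(\mathbf C^2)^{\mathrm{Vxs}(T)}$ be the closure of the set of generic drawings. $\mathcal T$ is *drawable* if a generic drawing exists. The dimension of $X(\mathcal T)$ is its dimension as an affine variety, i.e. the Krull dimension of its ring of polynomial functions. For a total order $\le$ on $\mathrm{Vxs}(T)$ with $\mathbf p\le\mathbf q\le\mathbf s\le\mathbf r\le v$ for every interior vertex $v$, call $C\in\mathcal C$ *relevant* to an interior vertex $v$ if $v\in C$ and $\#\{w\in C: w\le v\}\ge 3$. Put $\alpha_{\mathbf p}=\alpha_{\mathbf q}=\alpha_{\mathbf s}=2$, $\alpha_{\mathbf r}=0$, and $\alpha_v=2-\#\{C\in\mathcal C: C\text{ is relevant to }v\}$ for interior $v$. The order is a *drawing order* if $\alpha_v\ge0$ for every interior $v$. **Corollary.** Let $\mathcal T$ be drawable. Then $\sum_v\alpha_v$ has the same value for all drawing orders $\le$, and for every drawing order it equals both $\dim X(\mathcal T)$ and the heuristic count $$\sum_v\alpha_v=\dim X(\mathcal T)=6+2\,\#\{\text{interior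 vertices}\}-\sum_{C\in\mathcal C}(|C|-2).$$ -/

import Mathlib

/-- The geometric realization of a finite abstract simplicial complex with vertex set `V`:
the points of the standard simplex (barycentric coordinates) whose support is a face. -/
def realization {V : Type*} [Fintype V] (K : AbstractSimplicialComplex V) : Set (V → ℝ) :=
  {w | w ∈ stdSimplex ℝ V ∧ ∃ f ∈ K.faces, ∀ v, v ∈ f ↔ w v ≠ 0}

/-- The triangles (2-cells) of a complex. -/
def IsTriangle {V : Type*} (K : AbstractSimplicialComplex V) (t : Finset V) : Prop :=
  t ∈ K.faces ∧ t.card = 3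

/-- The dual graph: its vertices are the triangles, two distinct triangles being adjacent when they
share an edge. (It is a graph on all finite sets of vertices; only triangles have neighbours.) -/
def dualGraph {V : Type*} [DecidableEq V] (K : AbstractSimplicialComplex V) :
    SimpleGraph (Finset V) where
  Adj t u := IsTriangle K t ∧ IsTriangle K u ∧ t ≠ u ∧ (t ∩ u).card = 2
  symm := ⟨fun t u h => ⟨h.2.1, h.1, h.2.2.1.symm, by rw [Finset.inter_comm]; exact h.2.2.2⟩⟩
  loopless := ⟨fun _ h => h.2.2.1 rfl⟩

/-- A contiguous set of triangles: the triangles of `S` are the vertices of a connected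
(in particular nonempty) subgraph of the dual graph. -/
def IsContiguous {V : Type*} [DecidableEq V] (K : AbstractSimplicialComplex V)
    (S : Finset (Finset V)) : Prop :=
  (∀ t ∈ S, IsTriangle K t) ∧ ((dualGraph K).induce (S : Set (Finset V))).Connected

/-- A constrained triangulation (of a square) whose set of vertices is `V`: an oriented simplicial
complex homeomorphic to a closed disk, with four labelled corners, and a finite set of
collinearity constraints. -/
structure ConstrainedTriangulation (V : Type*) [Fintype V] [DecidableEq V] where
  /-- the underlying simplicial complex -/
  complex : AbstractSimplicialComplex V
  /-- the complex is homeomorphic to a closed disk -/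
  disk : Nonempty
    (realization complex ≃ₜ Metric.closedBall (0 : EuclideanSpace ℝ (Fin 2)) 1)
  /-- `pos x y z`: the ordered triple `(x, y, z)` is a positively oriented triangle -/
  pos : V → V → V → Prop
  pos_triangle : ∀ x y z, pos x y z →
    x ≠ y ∧ y ≠ z ∧ x ≠ z ∧ ({x, y, z} : Finset V) ∈ complex.faces
  pos_cyclic : ∀ x y z, pos x y z → pos y z x
  pos_or : ∀ x y z, x ≠ y → y ≠ z → x ≠ z → ({x, y, z} : Finset V) ∈ complex.faces →
    pos x y z ∨ pos y x z
  pos_asymm : ∀ x y z, pos x y z → ¬ pos y x z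
  /-- coherence: two triangles sharing an edge induce opposite directions on it -/
  pos_coherent : ∀ x y z z', pos x y z → pos x y z' → z = z'
  /-- the four corners -/
  p : V
  q : V
  r : V
  s : V
  corners_nodup : [p, q, r, s].Nodup
  /-- The boundary edges (the edges in exactly one triangle), with the direction induced by the
  orientation, are exactly `pq`, `qr`, `rs`, `sp`; so the corners are the boundary vertices,
  labelled in the cyclic order determined by the orientation. -/
  boundary : ∀ x y, ((∃ z, pos x y z) ∧ ∀ z, ¬ pos y x z) ↔
    (x = p ∧ y = q) ∨ (x = q ∧ y = r) ∨ (x = r ∧ y = s) ∨ (x = s ∧ y = p)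
  /-- the set of constraints, each of which is a set of vertices -/
  constraints : Finset (Finset V)
  /-- the constraints are the vertex sets of pairwise disjoint contiguous sets of triangles -/
  constraints_contiguous : ∃ S : Finset V → Finset (Finset V),
    (∀ C ∈ constraints, IsContiguous complex (S C) ∧ (S C).biUnion id = C) ∧
    ∀ C ∈ constraints, ∀ C' ∈ constraints, C ≠ C' → Disjoint (S C) (S C')

/-- A line in the affine plane `ℂ²`. -/
def IsLine (l : AffineSubspace ℂ (Fin 2 → ℂ)) : Prop :=
  (l : Set (Fin 2 → ℂ)).Nonempty ∧ Module.finrank ℂ l.direction = 1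

/-- A triangle in `ℂ²` is nondegenerate if its three vertices are not collinear. -/
def NondegTriangle (a b c : Fin 2 → ℂ) : Prop :=
  ¬ Collinear ℂ {a, b, c}

/-- A 4-gon is nondegenerate if no three cyclically consecutive vertices are collinear. -/
def NondegQuadrilateral (a b c d : Fin 2 → ℂ) : Prop :=
  [a, b, c, d].Nodup ∧
    NondegTriangle a b c ∧ NondegTriangle b c d ∧ NondegTriangle c d a ∧ NondegTriangle d a b

/-- The dimension of (the Zariski closure of) a set of points of complex affine space:
the Krull dimension of its ring of polynomial functions. -/
noncomputable def affineDim {σ : Type*} (Z : Set (σ → ℂ)) : WithBot ℕ∞ :=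
  ringKrullDim (MvPolynomial σ ℂ ⧸ MvPolynomial.vanishingIdeal ℂ Z)

namespace ConstrainedTriangulation

variable {V : Type*} [Fintype V] [DecidableEq V] (T : ConstrainedTriangulation V)

/-- A triangle is living if no constraint contains all of its vertices. -/
def IsLiving (t : Finset V) : Prop :=
  IsTriangle T.complex t ∧ ∀ C ∈ T.constraints, ¬ t ⊆ C

/-- Interior vertices are those which are not corners. -/
def IsInterior (v : V) : Prop := v ≠ T.p ∧ v ≠ T.q ∧ v ≠ T.r ∧ v ≠ T.s

/-- Drawings: the vertices in each constraint are on a line, and the corners form a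
(possibly degenerate) parallelogram. -/
def IsDrawing (ρ : V → Fin 2 → ℂ) : Prop :=
  (∀ C ∈ T.constraints, ∃ l, IsLine l ∧ ∀ v ∈ C, ρ v ∈ l) ∧ ρ T.p + ρ T.r = ρ T.q + ρ T.s

/-- Generic drawings. -/
def IsGenericDrawing (ρ : V → Fin 2 → ℂ) : Prop :=
  T.IsDrawing ρ ∧
  NondegQuadrilateral (ρ T.p) (ρ T.q) (ρ T.r) (ρ T.s) ∧
  (∀ x y z, x ≠ y → y ≠ z → x ≠ z → T.IsLiving {x, y, z} →
    NondegTriangle (ρ x) (ρ y) (ρ z)) ∧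
  Function.Injective ρ ∧
  (∀ C ∈ T.constraints, ∀ C' ∈ T.constraints, C ≠ C' → (C ∩ C').Nonempty →
    ∀ l l', IsLine l → IsLine l' → (∀ v ∈ C, ρ v ∈ l) → (∀ v ∈ C', ρ v ∈ l') → l ≠ l')

/-- The space `X`: the closure of the set of generic drawings. -/
def X : Set (V → Fin 2 → ℂ) := closure {ρ | T.IsGenericDrawing ρ}

/-- The dimension of `X`, as a subset of the affine space with coordinates indexed
by `V × Fin 2`. -/
noncomputable def dimX : WithBot ℕ∞ :=
  affineDim ((fun (ρ : V → Fin 2 → ℂ) (i : V × Fin 2) => ρ i.1 i.2) '' T.X)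

/-- There is a generic drawing. -/
def Drawable : Prop := ∃ ρ, T.IsGenericDrawing ρ

open Classical in
/-- The elements of the constraint `C` that do not come after `v` in the total order `L`. -/
noncomputable def upTo (L : LinearOrder V) (C : Finset V) (v : V) : Finset V :=
  C.filter (fun w => L.le w v)

/-- A set `C` is relevant to `v` if it contains `v` and at least three elements not after `v`. -/
def IsRelevant (L : LinearOrder V) (C : Finset V) (v : V) : Prop :=
  v ∈ C ∧ 3 ≤ (upTo L C v).card

open Classical in
/-- The number of degrees of freedom of `v`: it is `2` for `p`, `q`, `s`, it is `0` for `r`, and for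
an interior vertex it is `2` minus the number of constraints relevant to the vertex. -/
noncomputable def α (L : LinearOrder V) (v : V) : ℤ :=
  if v = T.p ∨ v = T.q ∨ v = T.s then 2
  else if v = T.r then 0
  else 2 - ((T.constraints.filter (fun C => IsRelevant L C v)).card : ℤ)

/-- A drawing order: a total order which starts with the corners `p`, `q`, `s`, `r` and for which
every interior vertex has a nonnegative number of degrees of freedom. -/
def IsDrawingOrder (L : LinearOrder V) : Prop :=
  L.le T.p T.q ∧ L.le T.q T.s ∧ L.le T.s T.r ∧
  ∀ v, T.IsInterior v → L.le T.r v ∧ 0 ≤ T.α L v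

open Classical in
/-- The heuristic count: `6` for the corners, plus `2` for each interior vertex, minus `1` for
each vertex beyond the second in each constraint (every constraint has at least three vertices). -/
noncomputable def heuristicDim : ℤ :=
  6 + 2 * ((Finset.univ.filter (fun v => T.IsInterior v)).card : ℤ) -
    ∑ C ∈ T.constraints, ((C.card : ℤ) - 2)

end ConstrainedTriangulation

/-! The equality with the heuristic count is a double count of pairs (vertex, relevant constraint).
A constraint is relevant to all of its vertices except the first two, hence to `|C| - 2` of them.
Drawability is needed to know that these vertices are interior: a relevant corner would put three
corners on one line.

For the dimension, place the vertices along the order. The parallelogram equation places `r`. Every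
other vertex `v` obeys two independent linear equations, one for each relevant constraint (the line
through its first two vertices), completed by `α v` equations that prescribe a coordinate. There are
`∑ α` prescribed coordinates in all.

Upper bound: by Cramer's rule the prescribed coordinates generate the field of all coordinates
(`RowSystem.mem_adjoin`). This is applied to the generic point of each component of `X`, so each
component has transcendence degree at most `∑ α` (`trdeg_le_sum_alpha`). Irreducibility of `X` is
not needed. Lower bound: near a generic drawing the prescribed coordinates can be varied freely and
genericity persists (`RowSystem.eventually_isGenericDrawing`). A polynomial relation between them on
`X` thus vanishes on an open set, so it is zero (`exists_comap_drawingIdeal_eq_bot`). Noether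
normalization turns the two bounds into the Krull dimension (`ringKrullDim_quotient_eq`). -/

/-! ### Krull dimension and transcendence degree -/

/-- Going up: an integral injective extension does not lower the Krull dimension. -/
theorem ringKrullDim_le_of_injective_isIntegral {A B : Type*} [CommRing A] [CommRing B]
    (f : A →+* B) (hf : Function.Injective f) (hint : f.IsIntegral) :
    ringKrullDim A ≤ ringKrullDim B := by
  algebraize [f]
  have : Algebra.IsIntegral A B := ⟨hint⟩
  -- Chains are lifted from the bottom upwards: lying over gives the first prime, going up each
  -- further one. Keeping track of the last prime makes the induction work.
  have key : ∀ c : LTSeries (PrimeSpectrum A), ∃ c' : LTSeries (PrimeSpectrum B),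
      c'.length = c.length ∧ c'.last.comap f = c.last := by
    intro c
    induction c using RelSeries.inductionOn' with
    | singleton x =>
      obtain ⟨Q, -, hQ, hQx⟩ := Ideal.exists_ideal_over_prime_of_isIntegral (S := B)
        x.asIdeal ⊥ (by
          intro a ha
          have : f a = 0 := by simpa [RingHom.algebraMap_toAlgebra] using ha
          have : a = 0 := hf (by simpa using this)
          simp [this])
      exact ⟨RelSeries.singleton _ ⟨Q, hQ⟩, rfl, PrimeSpectrum.ext hQx⟩
    | snoc c x hx ih =>
      obtain ⟨c', hlen, hlast⟩ := ih
      obtain ⟨Q, hle, hQ, hQx⟩ := Ideal.exists_ideal_over_prime_of_isIntegral_of_isPrime (S := B)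
        x.asIdeal c'.last.asIdeal (by
          have : c'.last.asIdeal.comap f = c.last.asIdeal := congrArg PrimeSpectrum.asIdeal hlast
          exact this.le.trans (le_of_lt (show c.last < x from hx)))
      have hlt : c'.last < ⟨Q, hQ⟩ := by
        refine lt_of_le_of_ne hle fun h => ?_
        have h1 : c.last = x := by
          rw [← hlast, h]; exact PrimeSpectrum.ext hQx
        exact absurd (show c.last < x from hx) (h1 ▸ lt_irrefl _)
      refine ⟨c'.snoc ⟨Q, hQ⟩ hlt, by simp [hlen], ?_⟩
      simp only [RelSeries.last_snoc]
      exact PrimeSpectrum.ext hQx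
  refine iSup_le fun c => ?_
  obtain ⟨c', hlen, -⟩ := key c
  rw [← hlen]
  exact le_iSup (fun c : LTSeries (PrimeSpectrum B) => (c.length : WithBot ℕ∞)) c'

/-- Going up gives one inequality. For the other, contraction of primes is strictly monotone by
incomparability. -/
theorem ringKrullDim_eq_of_injective_isIntegral {A B : Type*} [CommRing A] [CommRing B]
    (f : A →+* B) (hf : Function.Injective f) (hint : f.IsIntegral) :
    ringKrullDim B = ringKrullDim A := by
  refine le_antisymm ?_ (ringKrullDim_le_of_injective_isIntegral f hf hint)
  algebraize [f]
  have : Algebra.IsIntegral A B := ⟨hint⟩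
  refine Order.krullDim_le_of_strictMono (PrimeSpectrum.comap f) fun P Q h => ?_
  exact Ideal.IsIntegral.comap_lt_comap (R := A) (show P.asIdeal < Q.asIdeal from h)

/-- The Krull dimension of a finitely generated algebra, computed from its number of Noether
parameters, which are lifted to the polynomial ring. -/
theorem exists_noether_parameters {τ : Type*} [Finite τ] (k : Type*) [Field k]
    (I : Ideal (MvPolynomial τ k)) (hI : I ≠ ⊤) :
    ∃ (s : ℕ) (g : MvPolynomial (Fin s) k →ₐ[k] MvPolynomial τ k),
      I.comap g = ⊥ ∧ ((Ideal.Quotient.mkₐ k I).comp g).IsIntegral ∧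
      ringKrullDim (MvPolynomial τ k ⧸ I) = s := by
  have : Nontrivial (MvPolynomial τ k ⧸ I) := Ideal.Quotient.nontrivial_iff.mpr hI
  obtain ⟨s, g, hg, hint⟩ := exists_integral_inj_algHom_of_fg k (MvPolynomial τ k ⧸ I)
  choose y hy using fun i => Ideal.Quotient.mk_surjective (g (MvPolynomial.X i))
  have hcomp : (Ideal.Quotient.mkₐ k I).comp (MvPolynomial.aeval y) = g := by
    ext i
    simp [hy]
  refine ⟨s, MvPolynomial.aeval y, ?_, by rwa [hcomp], ?_⟩
  · refine (Submodule.eq_bot_iff _).mpr fun f hf => hg ?_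
    rw [map_zero, ← hcomp]
    exact Ideal.Quotient.eq_zero_iff_mem.mpr hf
  · rw [ringKrullDim_eq_of_injective_isIntegral g.toRingHom hg hint,
      MvPolynomial.ringKrullDim_of_isNoetherianRing]
    simp

/-- If no relation in `I` involves only the polynomials `φ X`, some minimal prime over `I`
has transcendence degree at least the number of these polynomials. -/
theorem exists_minimalPrimes_le_trdeg {σ τ k : Type*} [Field k] [Fintype σ]
    (I : Ideal (MvPolynomial τ k)) (φ : MvPolynomial σ k →ₐ[k] MvPolynomial τ k)
    (hφ : I.comap φ = ⊥) :
    ∃ P ∈ I.minimalPrimes, (Fintype.card σ : Cardinal) ≤ Algebra.trdeg k (MvPolynomial τ k ⧸ P) := by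
  -- The zero ideal is a minimal prime over the contraction of `I`, so it is the contraction of a
  -- minimal prime over `I`.
  obtain ⟨P, hP, hPφ⟩ := Ideal.exists_minimalPrimes_comap_eq (I := I) φ.toRingHom ⊥ (by
    have : I.comap φ.toRingHom = ⊥ := hφ
    rw [this]
    simp [IsDomain.minimalPrimes_eq_singleton_bot])
  refine ⟨P, hP, ?_⟩
  have hinj : Function.Injective ((Ideal.Quotient.mkₐ k P).comp φ) := by
    rw [injective_iff_map_eq_zero]
    intro f hf
    have : f ∈ P.comap φ.toRingHom :=
      Ideal.mem_comap.mpr (Ideal.Quotient.eq_zero_iff_mem.mp hf)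
    rwa [hPφ] at this
  have := lift_trdeg_le_of_injective _ hinj
  rw [MvPolynomial.trdeg_of_isDomain] at this
  simpa using this

/-- `A` is algebraic over the subalgebra generated by the `n` images of the variables. The map need
not be injective, because Noether parameters of the whole variety may become dependent on a
component. -/
theorem trdeg_le_of_isIntegral {n : ℕ} {k A : Type*} [Field k] [CommRing A] [IsDomain A]
    [Algebra k A] (g : MvPolynomial (Fin n) k →ₐ[k] A) (hg : g.IsIntegral) :
    Algebra.trdeg k A ≤ n := by
  have hr : Algebra.adjoin k (Set.range fun i => g (MvPolynomial.X i)) = g.range := by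
    rw [Algebra.adjoin_range_eq_range_aeval]
    congr 1
    ext i
    simp
  have : Algebra.IsAlgebraic (Algebra.adjoin k (Set.range fun i => g (MvPolynomial.X i))) A := by
    rw [hr]
    have : Algebra.IsIntegral g.range A := ⟨fun a => by
      obtain ⟨p, hp, hpa⟩ := hg a
      refine ⟨p.map g.rangeRestrict.toRingHom, hp.map _, ?_⟩
      rw [Polynomial.eval₂_map]
      exact hpa⟩
    infer_instance
  refine (Algebra.IsAlgebraic.trdeg_le_cardinalMk k
    (Set.range fun i => g (MvPolynomial.X i))).trans ?_
  have := Cardinal.mk_range_le_lift (f := fun i => g (MvPolynomial.X i))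
  simpa using this

/-- The Krull dimension of a quotient of a polynomial ring is `#σ` if `#σ` polynomials are
independent modulo `I` and the components have transcendence degree at most `#σ`. -/
theorem ringKrullDim_quotient_eq {σ τ k : Type*} [Field k] [Fintype σ] [Finite τ]
    (I : Ideal (MvPolynomial τ k)) (hI : I ≠ ⊤) (φ : MvPolynomial σ k →ₐ[k] MvPolynomial τ k)
    (hφ : I.comap φ = ⊥)
    (htr : ∀ P ∈ I.minimalPrimes, Algebra.trdeg k (MvPolynomial τ k ⧸ P) ≤ Fintype.card σ) :
    ringKrullDim (MvPolynomial τ k ⧸ I) = Fintype.card σ := by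
  obtain ⟨s, g, hg, hint, hdim⟩ := exists_noether_parameters k I hI
  rw [hdim]
  congr 1
  have h1 : s ≤ Fintype.card σ := by
    obtain ⟨P, hP, hle⟩ := exists_minimalPrimes_le_trdeg I g hg
    simpa using hle.trans (htr P hP)
  have h2 : Fintype.card σ ≤ s := by
    obtain ⟨P, hP, hle⟩ := exists_minimalPrimes_le_trdeg I φ hφ
    have := hP.isPrime
    have hPint : ((Ideal.Quotient.mkₐ k P).comp g).IsIntegral := by
      have h3 : (Ideal.Quotient.mkₐ k P).comp g =
          (Ideal.Quotient.factorₐ k hP.le).comp ((Ideal.Quotient.mkₐ k I).comp g) := by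
        ext; simp
      rw [h3]
      exact hint.trans _ _ (RingHom.isIntegral_of_surjective _ (Ideal.Quotient.factor_surjective hP.le))
    exact_mod_cast hle.trans (trdeg_le_of_isIntegral _ hPint)
  exact_mod_cast le_antisymm h1 h2

open scoped IntermediateField.algebraAdjoinAdjoin in
/-- An algebra embedded in the field generated by a finite family has transcendence degree
at most the size of the family. -/
theorem trdeg_le_card_of_mem_adjoin {σ k A K : Type*} [Field k] [CommRing A] [Algebra k A]
    [Field K] [Algebra k K] [Fintype σ] (f : A →ₐ[k] K) (hf : Function.Injective f)
    (t : σ → K) (h : ∀ a, f a ∈ IntermediateField.adjoin k (Set.range t)) :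
    Algebra.trdeg k A ≤ Fintype.card σ := by
  let S := Algebra.adjoin k (Set.range t)
  let F := IntermediateField.adjoin k (Set.range t)
  have hSF : Algebra.trdeg k S = Algebra.trdeg k F := by
    have := trdeg_add_eq k S (A := F)
    rwa [trdeg_eq_zero (R := S) (A := F), add_zero] at this
  have hS : Algebra.trdeg k S ≤ Fintype.card σ := by
    have hr : S = (MvPolynomial.aeval t : MvPolynomial σ k →ₐ[k] K).range :=
      Algebra.adjoin_range_eq_range_aeval k t
    rw [hr]
    have := lift_trdeg_le_of_surjective _ (MvPolynomial.aeval t : MvPolynomial σ k →ₐ[k] K).rangeRestrict_surjective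
    rw [MvPolynomial.trdeg_of_isDomain] at this
    simpa using this
  have hA := lift_trdeg_le_of_injective (f.codRestrict F.toSubalgebra h)
    ((AlgHom.injective_codRestrict f _ h).mpr hf)
  have := hA.trans (Cardinal.lift_le.mpr (hSF ▸ hS))
  simpa using this

/-! ### Plane geometry by determinants -/

/-- The determinant of two vectors in the plane. -/
def cross {A : Type*} [CommRing A] (u w : Fin 2 → A) : A := u 0 * w 1 - u 1 * w 0

theorem map_cross {A B : Type*} [CommRing A] [CommRing B] (φ : A →+* B) (u w : Fin 2 → A) :
    φ (cross u w) = cross (fun i => φ (u i)) (fun i => φ (w i)) := by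
  simp [cross]

/-- Cramer's rule. -/
theorem eq_of_cross_eq {K : Type*} [Field K] {u w z : Fin 2 → K} (h : cross u w ≠ 0) (i : Fin 2) :
    z i = (w i * cross u z - u i * cross w z) / cross u w := by
  rw [eq_div_iff h]
  fin_cases i <;> simp [cross] <;> ring

theorem cross_cramer_left {K : Type*} [Field K] {u w : Fin 2 → K} (h : cross u w ≠ 0) (c d : K) :
    cross u (fun i => (w i * c - u i * d) / cross u w) = c := by
  have : cross u (fun i => (w i * c - u i * d) / cross u w) = (cross u w) * c / cross u w := by
    simp only [cross]; ring
  rw [this, mul_div_cancel_left₀ _ h]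

theorem cross_cramer_right {K : Type*} [Field K] {u w : Fin 2 → K} (h : cross u w ≠ 0) (c d : K) :
    cross w (fun i => (w i * c - u i * d) / cross u w) = d := by
  have : cross w (fun i => (w i * c - u i * d) / cross u w) = (cross u w) * d / cross u w := by
    simp only [cross]; ring
  rw [this, mul_div_cancel_left₀ _ h]

/-- Two vectors parallel to a nonzero vector are parallel. -/
theorem cross_eq_zero_of_parallel {K : Type*} [Field K] {e u w : Fin 2 → K} (he : e ≠ 0)
    (hu : cross e u = 0) (hw : cross e w = 0) : cross u w = 0 := by
  by_contra h
  apply he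
  have h0 := eq_of_cross_eq (z := e) h
  have hu' : cross u e = 0 := by rw [← neg_eq_zero, ← hu]; simp [cross]; ring
  have hw' : cross w e = 0 := by rw [← neg_eq_zero, ← hw]; simp [cross]; ring
  funext i
  rw [h0 i, hu', hw']; simp

theorem exists_smul_of_cross_eq_zero {K : Type*} [Field K] {u w : Fin 2 → K} (hu : u ≠ 0)
    (h : cross u w = 0) : ∃ c : K, w = c • u := by
  obtain ⟨i, hi⟩ := Function.ne_iff.mp hu
  refine ⟨w i / u i, funext fun j => ?_⟩
  have hi' : u i ≠ 0 := hi
  simp only [Pi.smul_apply, smul_eq_mul]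
  field_simp
  fin_cases i <;> fin_cases j <;> simp [cross] at h ⊢ <;>
    first | linear_combination h | linear_combination -h

theorem cross_smul_self {K : Type*} [Field K] (u : Fin 2 → K) (c d : K) :
    cross (c • u) (d • u) = 0 := by
  simp [cross]; ring

theorem collinear_iff_cross {K : Type*} [Field K] (a b c : Fin 2 → K) :
    Collinear K {a, b, c} ↔ cross (b - a) (c - a) = 0 := by
  rw [collinear_iff_of_mem (p₀ := a) (by simp)]
  constructor
  · rintro ⟨v, hv⟩
    obtain ⟨x, hx⟩ := hv b (by simp)
    obtain ⟨y, hy⟩ := hv c (by simp)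
    rw [hx, hy]
    simpa using cross_smul_self v x y
  · intro h
    by_cases hab : b - a = 0
    · refine ⟨c - a, ?_⟩
      rintro p (rfl | rfl | rfl)
      · exact ⟨0, by simp⟩
      · exact ⟨0, by simp [sub_eq_zero.mp hab]⟩
      · exact ⟨1, by simp⟩
    · obtain ⟨x, hx⟩ := exists_smul_of_cross_eq_zero hab h
      refine ⟨b - a, ?_⟩
      rintro p (rfl | rfl | rfl)
      · exact ⟨0, by simp⟩
      · exact ⟨1, by simp⟩
      · exact ⟨x, by simp [← hx]⟩

theorem nondegTriangle_iff (a b c : Fin 2 → ℂ) :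
    NondegTriangle a b c ↔ cross (b - a) (c - a) ≠ 0 := by
  rw [NondegTriangle, collinear_iff_cross]

theorem isLine_affineSpan_pair {a b : Fin 2 → ℂ} (h : a ≠ b) : IsLine (line[ℂ, a, b]) := by
  refine ⟨⟨a, left_mem_affineSpan_pair ℂ a b⟩, ?_⟩
  rw [direction_affineSpan, vectorSpan_pair_rev]
  exact finrank_span_singleton (by simpa [sub_eq_zero] using h.symm)

theorem mem_affineSpan_pair_of_cross {a b c : Fin 2 → ℂ} (h : a ≠ b)
    (hc : cross (b - a) (c - a) = 0) : c ∈ line[ℂ, a, b] := by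
  obtain ⟨x, hx⟩ := exists_smul_of_cross_eq_zero (sub_ne_zero.mpr h.symm) hc
  have : c = AffineMap.lineMap a b x := by
    rw [AffineMap.lineMap_apply, vsub_eq_sub, ← hx]; simp
  rw [this]
  exact AffineMap.lineMap_mem_affineSpan_pair x a b

theorem IsLine.direction_eq_span {l : AffineSubspace ℂ (Fin 2 → ℂ)} (hl : IsLine l)
    {a b : Fin 2 → ℂ} (ha : a ∈ l) (hb : b ∈ l) (hab : a ≠ b) :
    l.direction = Submodule.span ℂ {b - a} := by
  symm
  apply Submodule.eq_of_le_of_finrank_eq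
  · rw [Submodule.span_singleton_le_iff_mem]
    exact AffineSubspace.vsub_mem_direction hb ha
  · rw [hl.2, finrank_span_singleton (sub_ne_zero.mpr hab.symm)]

theorem IsLine.cross_eq_zero {l : AffineSubspace ℂ (Fin 2 → ℂ)} (hl : IsLine l)
    {a b a' b' : Fin 2 → ℂ} (ha : a ∈ l) (hb : b ∈ l) (ha' : a' ∈ l) (hb' : b' ∈ l) :
    cross (b - a) (b' - a') = 0 := by
  by_cases hab : a = b
  · simp [hab, cross]
  · have h := AffineSubspace.vsub_mem_direction hb' ha'
    rw [hl.direction_eq_span ha hb hab, Submodule.mem_span_singleton] at h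
    obtain ⟨c, hc⟩ := h
    rw [← vsub_eq_sub b' a', ← hc]
    simpa using cross_smul_self (b - a) 1 c

theorem IsLine.eq_of_cross_eq_zero {l l' : AffineSubspace ℂ (Fin 2 → ℂ)} (hl : IsLine l)
    (hl' : IsLine l') {x a b a' b' : Fin 2 → ℂ} (hx : x ∈ l) (hx' : x ∈ l') (ha : a ∈ l)
    (hb : b ∈ l) (hab : a ≠ b) (ha' : a' ∈ l') (hb' : b' ∈ l') (hab' : a' ≠ b')
    (h : cross (b - a) (b' - a') = 0) : l = l' := by
  refine AffineSubspace.ext_of_direction_eq ?_ ⟨x, hx, hx'⟩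
  obtain ⟨c, hc⟩ := exists_smul_of_cross_eq_zero (sub_ne_zero.mpr hab.symm) h
  rw [hl.direction_eq_span ha hb hab, hl'.direction_eq_span ha' hb' hab']
  symm
  apply Submodule.eq_of_le_of_finrank_eq
  · rw [Submodule.span_singleton_le_iff_mem, Submodule.mem_span_singleton]
    exact ⟨c, hc.symm⟩
  · rw [finrank_span_singleton (sub_ne_zero.mpr hab.symm),
      finrank_span_singleton (sub_ne_zero.mpr hab'.symm)]

/-! ### Generic drawings in determinant form -/

namespace ConstrainedTriangulation

variable {V : Type*} [Fintype V] [DecidableEq V] (T : ConstrainedTriangulation V)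

/-- A contiguous set of triangles is nonempty, and one triangle already supplies three vertices. -/
theorem three_le_card {C : Finset V} (hC : C ∈ T.constraints) : 3 ≤ C.card := by
  obtain ⟨S, hS, -⟩ := T.constraints_contiguous
  obtain ⟨⟨htri, hconn⟩, hU⟩ := hS C hC
  obtain ⟨t, ht⟩ := hconn.nonempty
  rw [← (htri t ht).2, ← hU]
  exact Finset.card_le_card (Finset.subset_biUnion_of_mem id ht)

/-- Placements of the vertices in a plane over a field which satisfy the equations and
nondegeneracy conditions of generic drawings that involve the constraints. -/
structure GeneralPosition {K : Type*} [Field K] (ρ : V → Fin 2 → K) : Prop where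
  collinear : ∀ C ∈ T.constraints, ∀ a ∈ C, ∀ b ∈ C, ∀ c ∈ C, cross (ρ b - ρ a) (ρ c - ρ a) = 0
  parallelogram : ρ T.p + ρ T.r = ρ T.q + ρ T.s
  injective : Function.Injective ρ
  transversal : ∀ C ∈ T.constraints, ∀ C' ∈ T.constraints, C ≠ C' → (C ∩ C').Nonempty →
    ∀ a ∈ C, ∀ b ∈ C, a ≠ b → ∀ a' ∈ C', ∀ b' ∈ C', a' ≠ b' → cross (ρ b - ρ a) (ρ b' - ρ a') ≠ 0

/-- The determinant form of the nondegeneracy of the corners and the living triangles. -/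
def NondegenerateTriangles (ρ : V → Fin 2 → ℂ) : Prop :=
  cross (ρ T.q - ρ T.p) (ρ T.r - ρ T.p) ≠ 0 ∧ cross (ρ T.r - ρ T.q) (ρ T.s - ρ T.q) ≠ 0 ∧
  cross (ρ T.s - ρ T.r) (ρ T.p - ρ T.r) ≠ 0 ∧ cross (ρ T.p - ρ T.s) (ρ T.q - ρ T.s) ≠ 0 ∧
  ∀ x y z, x ≠ y → y ≠ z → x ≠ z → T.IsLiving {x, y, z} → cross (ρ y - ρ x) (ρ z - ρ x) ≠ 0

variable {T}

/-- Two distinct vertices of a constraint span its line, and lines of two constraints with a common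
vertex would coincide if they were parallel. -/
theorem IsGenericDrawing.generalPosition {ρ : V → Fin 2 → ℂ} (h : T.IsGenericDrawing ρ) :
    T.GeneralPosition ρ := by
  obtain ⟨⟨hline, hpar⟩, -, -, hinj, htr⟩ := h
  refine ⟨fun C hC a ha b hb c hc => ?_, hpar, hinj, ?_⟩
  · obtain ⟨l, hl, hCl⟩ := hline C hC
    exact hl.cross_eq_zero (hCl a ha) (hCl b hb) (hCl a ha) (hCl c hc)
  · intro C hC C' hC' hne hint a ha b hb hab a' ha' b' hb' hab' h0
    obtain ⟨l, hl, hCl⟩ := hline C hC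
    obtain ⟨l', hl', hCl'⟩ := hline C' hC'
    obtain ⟨x, hx⟩ := id hint
    rw [Finset.mem_inter] at hx
    exact htr C hC C' hC' hne hint l l' hl hl' hCl hCl'
      (hl.eq_of_cross_eq_zero hl' (hCl x hx.1) (hCl' x hx.2) (hCl a ha) (hCl b hb) (hinj.ne hab)
        (hCl' a' ha') (hCl' b' hb') (hinj.ne hab') h0)

theorem IsGenericDrawing.nondegenerateTriangles {ρ : V → Fin 2 → ℂ} (h : T.IsGenericDrawing ρ) :
    T.NondegenerateTriangles ρ := by
  obtain ⟨-, ⟨-, h1, h2, h3, h4⟩, hliv, -⟩ := h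
  simp only [nondegTriangle_iff] at h1 h2 h3 h4 hliv
  exact ⟨h1, h2, h3, h4, hliv⟩

/-- The conditions are split in two because `GeneralPosition` is also needed over function fields,
whereas the remaining triangle conditions only have to persist near a complex drawing. -/
theorem GeneralPosition.isGenericDrawing {ρ : V → Fin 2 → ℂ} (h : T.GeneralPosition ρ)
    (hN : T.NondegenerateTriangles ρ) : T.IsGenericDrawing ρ := by
  have htwo : ∀ C ∈ T.constraints, ∃ a ∈ C, ∃ b ∈ C, a ≠ b := fun C hC =>
    Finset.one_lt_card.mp ((show 1 < 3 by norm_num).trans_le (T.three_le_card hC))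
  obtain ⟨h1, h2, h3, h4, hliv⟩ := hN
  refine ⟨⟨fun C hC => ?_, h.parallelogram⟩, ⟨?_, ?_⟩, ?_, h.injective, ?_⟩
  · obtain ⟨a, ha, b, hb, hab⟩ := htwo C hC
    exact ⟨_, isLine_affineSpan_pair (h.injective.ne hab), fun v hv =>
      mem_affineSpan_pair_of_cross (h.injective.ne hab) (h.collinear C hC a ha b hb v hv)⟩
  · exact T.corners_nodup.map h.injective
  · simp only [nondegTriangle_iff]
    exact ⟨h1, h2, h3, h4⟩
  · simpa only [nondegTriangle_iff] using hliv
  · rintro C hC C' hC' hne hint l l' hl - hCl hCl' rfl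
    obtain ⟨a, ha, b, hb, hab⟩ := htwo C hC
    obtain ⟨a', ha', b', hb', hab'⟩ := htwo C' hC'
    exact h.transversal C hC C' hC' hne hint a ha b hb hab a' ha' b' hb' hab'
      (hl.cross_eq_zero (hCl a ha) (hCl b hb) (hCl' a' ha') (hCl' b' hb'))

/-- In a drawable triangulation no constraint contains three corners. -/
theorem NondegenerateTriangles.corners_not_mem {ρ : V → Fin 2 → ℂ} (h : T.GeneralPosition ρ)
    (hN : T.NondegenerateTriangles ρ) {C : Finset V} (hC : C ∈ T.constraints) {a b c : V}
    (ha : a ∈ C) (hb : b ∈ C) (hc : c ∈ C) (hab : a ≠ b) (hac : a ≠ c) (hbc : b ≠ c)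
    (hai : ¬ T.IsInterior a) (hbi : ¬ T.IsInterior b) (hci : ¬ T.IsInterior c) : False := by
  obtain ⟨h1, h2, h3, h4, -⟩ := hN
  -- Any three of the four corners are cyclically consecutive, so these four cases are exhaustive.
  have k1 : ¬ (T.p ∈ C ∧ T.q ∈ C ∧ T.r ∈ C) := fun k => h1 (h.collinear C hC _ k.1 _ k.2.1 _ k.2.2)
  have k2 : ¬ (T.q ∈ C ∧ T.r ∈ C ∧ T.s ∈ C) := fun k => h2 (h.collinear C hC _ k.1 _ k.2.1 _ k.2.2)
  have k3 : ¬ (T.r ∈ C ∧ T.s ∈ C ∧ T.p ∈ C) := fun k => h3 (h.collinear C hC _ k.1 _ k.2.1 _ k.2.2)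
  have k4 : ¬ (T.s ∈ C ∧ T.p ∈ C ∧ T.q ∈ C) := fun k => h4 (h.collinear C hC _ k.1 _ k.2.1 _ k.2.2)
  clear h h1 h2 h3 h4
  simp only [IsInterior] at hai hbi hci
  grind (splits := 30)

/-! ### The double count of relevant constraints -/

omit [Fintype V] in
/-- The first two elements of a constraint. -/
theorem exists_first_two (L : LinearOrder V) {C : Finset V} (hC : 3 ≤ C.card) :
    ∃ a ∈ C, ∃ b ∈ C, a ≠ b ∧ (∀ v ∈ C, v = a ∨ v = b ∨ (L.lt a v ∧ L.lt b v)) ∧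
      ∀ v, IsRelevant L C v ↔ v ∈ C ∧ v ≠ a ∧ v ≠ b := by
  let := L
  obtain ⟨a, ha, hamin⟩ := C.exists_min_image id (Finset.card_pos.mp (by omega))
  obtain ⟨b, hb, hbmin⟩ := (C.erase a).exists_min_image id
    (Finset.card_pos.mp (by rw [Finset.card_erase_of_mem ha]; omega))
  obtain ⟨hba, hb⟩ := Finset.mem_erase.mp hb
  simp only [id_eq] at hamin hbmin
  have hlt : ∀ v ∈ C, v ≠ a → v ≠ b → a < v ∧ b < v := fun v hv hva hvb =>
    ⟨lt_of_le_of_ne (hamin v hv) hva.symm,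
      lt_of_le_of_ne (hbmin v (Finset.mem_erase.mpr ⟨hva, hv⟩)) hvb.symm⟩
  have hab : a < b := lt_of_le_of_ne (hamin b hb) hba.symm
  have hupTo : ∀ v w, w ∈ upTo L C v ↔ w ∈ C ∧ w ≤ v := fun v w => by
    simp only [upTo, Finset.mem_filter]
  refine ⟨a, ha, b, hb, hba.symm, fun v hv => ?_, fun v => ⟨fun ⟨hv, hcard⟩ => ?_, ?_⟩⟩
  · by_cases hva : v = a
    · exact Or.inl hva
    by_cases hvb : v = b
    · exact Or.inr (Or.inl hvb)
    exact Or.inr (Or.inr (hlt v hv hva hvb))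
  -- Up to `b` the constraint contains at most the elements `a` and `b`, too few for relevance.
  · have key : ¬ v ≤ b := fun hvb => by
      have hsub : upTo L C v ⊆ {a, b} := fun w hw => by
        obtain ⟨hw, hwv⟩ := (hupTo v w).mp hw
        by_contra hn
        simp only [Finset.mem_insert, Finset.mem_singleton, not_or] at hn
        exact absurd (hlt w hw hn.1 hn.2).2 (not_lt.mpr (hwv.trans hvb))
      have := (Finset.card_le_card hsub).trans Finset.card_le_two
      omega
    exact ⟨hv, fun h => key (h ▸ hab.le), fun h => key h.le⟩
  · rintro ⟨hv, hva, hvb⟩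
    obtain ⟨h1, h2⟩ := hlt v hv hva hvb
    refine ⟨hv, ?_⟩
    have hsub : {a, b, v} ⊆ upTo L C v := by
      intro w hw
      simp only [Finset.mem_insert, Finset.mem_singleton] at hw
      rw [hupTo]
      rcases hw with rfl | rfl | rfl
      exacts [⟨ha, h1.le⟩, ⟨hb, h2.le⟩, ⟨hv, le_rfl⟩]
    rw [← Finset.card_eq_three.mpr ⟨a, b, v, hba.symm, hva.symm, hvb.symm, rfl⟩]
    exact Finset.card_le_card hsub

theorem card_filter_isRelevant (L : LinearOrder V) {C : Finset V} (hC : C ∈ T.constraints)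
    [DecidablePred fun v => IsRelevant L C v] :
    ((Finset.univ.filter fun v => IsRelevant L C v).card : ℤ) = (C.card : ℤ) - 2 := by
  have h3 := T.three_le_card hC
  obtain ⟨a, ha, b, hb, hab, -, hrel⟩ := exists_first_two L h3
  have : (Finset.univ.filter fun v => IsRelevant L C v) = (C.erase a).erase b := by
    ext v
    simp only [Finset.mem_filter, Finset.mem_univ, true_and, hrel, Finset.mem_erase]
    tauto
  rw [this, Finset.card_erase_of_mem (Finset.mem_erase.mpr ⟨hab.symm, hb⟩),
    Finset.card_erase_of_mem ha]
  omega

/-- The corners come first in the order. If a relevant `v` were a corner, the first two vertices of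
`C`, which precede it, would be corners as well. -/
theorem IsDrawingOrder.isInterior {L : LinearOrder V} (hL : T.IsDrawingOrder L)
    (hT : T.Drawable) {C : Finset V} (hC : C ∈ T.constraints) {v : V} (hv : IsRelevant L C v) :
    T.IsInterior v := by
  obtain ⟨ρ, hρ⟩ := hT
  obtain ⟨a, ha, b, hb, hab, hlt, hrel⟩ := exists_first_two L (T.three_le_card hC)
  obtain ⟨hvC, hva, hvb⟩ := (hrel v).mp hv
  obtain ⟨hav, hbv⟩ := ((hlt v hvC).resolve_left hva).resolve_left hvb
  by_contra hvi
  let := L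
  have hvr : v ≤ T.r := by
    have h1 : T.p ≤ T.q := hL.1
    have h2 : T.q ≤ T.s := hL.2.1
    have h3 : T.s ≤ T.r := hL.2.2.1
    simp only [IsInterior] at hvi
    by_contra hn
    exact hvi ⟨fun h => hn (h ▸ (h1.trans h2).trans h3), fun h => hn (h ▸ h2.trans h3),
      fun h => hn h.le, fun h => hn (h ▸ h3)⟩
  have hcorner : ∀ w : V, w < v → ¬ T.IsInterior w := fun w hw hwi =>
    absurd (hL.2.2.2 w hwi).1 (not_le.mpr (show w < T.r from hw.trans_le hvr))
  exact hρ.nondegenerateTriangles.corners_not_mem hρ.generalPosition hC ha hb hvC hab hva.symm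
    hvb.symm (hcorner a hav) (hcorner b hbv) hvi

open Classical in
-- No constraint is relevant to a corner, so one formula covers corners and interior vertices and
-- can be summed over all of `V`.
theorem IsDrawingOrder.alpha_eq {L : LinearOrder V} (hL : T.IsDrawingOrder L) (hT : T.Drawable)
    (v : V) : T.α L v =
      (if v = T.r then 0 else 2) - ((T.constraints.filter fun C => IsRelevant L C v).card : ℤ) := by
  by_cases hv : T.IsInterior v
  · simp [α, hv.1, hv.2.1, hv.2.2.1, hv.2.2.2]
  · have h0 : (T.constraints.filter fun C => IsRelevant L C v) = ∅ :=
      Finset.filter_eq_empty_iff.mpr fun C hC h => hv (hL.isInterior hT hC h)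
    have hnd := T.corners_nodup
    simp only [List.nodup_cons, List.mem_cons, List.not_mem_nil, or_false, not_or] at hnd
    obtain ⟨⟨-, hpr, -⟩, ⟨hqr, -⟩, hrs, -⟩ := hnd
    rw [h0]
    simp only [IsInterior, α] at hv ⊢
    by_cases h1 : v = T.r
    · subst h1
      simp [Ne.symm hpr, Ne.symm hqr, hrs]
    · have : v = T.p ∨ v = T.q ∨ v = T.s := by tauto
      simp [this, h1]

theorem card_isInterior [DecidablePred T.IsInterior] :
    (Fintype.card V : ℤ) = 4 + ((Finset.univ.filter fun v => T.IsInterior v).card : ℤ) := by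
  have h : (Finset.univ.filter fun v => T.IsInterior v) = Finset.univ \ [T.p, T.q, T.r, T.s].toFinset := by
    ext v
    simp only [Finset.mem_filter]
    simp [IsInterior]
  have h4 := List.toFinset_card_of_nodup T.corners_nodup
  have := Finset.card_sdiff_add_card_eq_card (Finset.subset_univ [T.p, T.q, T.r, T.s].toFinset)
  rw [h4] at this
  rw [h, ← Finset.card_univ, ← this]
  simp; ring

/-- For every drawing order the degrees of freedom add up to the heuristic dimension. -/
theorem IsDrawingOrder.sum_alpha {L : LinearOrder V} (hL : T.IsDrawingOrder L) (hT : T.Drawable) :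
    ∑ v, T.α L v = T.heuristicDim := by
  classical
  simp_rw [hL.alpha_eq hT]
  rw [Finset.sum_sub_distrib]
  -- Pairs of a vertex and a constraint relevant to it are counted in both ways.
  have h1 : ∑ v, ((T.constraints.filter fun C => IsRelevant L C v).card : ℤ) =
      ∑ C ∈ T.constraints, ((C.card : ℤ) - 2) := by
    rw [← Finset.sum_congr rfl fun C hC => card_filter_isRelevant L hC]
    exact_mod_cast Finset.sum_card_bipartiteAbove_eq_sum_card_bipartiteBelow
      (s := Finset.univ) (t := T.constraints) fun v C => IsRelevant L C v
  have h2 : ∑ v : V, (if v = T.r then 0 else 2 : ℤ) = 2 * Fintype.card V - 2 := by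
    have : ∀ v : V, (if v = T.r then 0 else 2 : ℤ) = 2 - if v = T.r then 2 else 0 := fun v => by
      split_ifs <;> simp
    simp only [this, Finset.sum_sub_distrib, Finset.sum_ite_eq', Finset.mem_univ, if_true]
    simp [mul_comm]
  rw [h1, h2, card_isInterior (T := T), heuristicDim]
  congr 1
  ring

end ConstrainedTriangulation

/-! ### Two linear equations for each vertex, and the upper bound -/

namespace ConstrainedTriangulation

/-- A linear equation for the position of a vertex: one of its coordinates is prescribed, or
it lies on the line through two other vertices. -/
inductive Row (V : Type*)
  | coord (i : Fin 2)
  | line (a b : V)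

namespace Row

variable {V : Type*}

/-- The rows which prescribe a coordinate. -/
def IsCoord : Row V → Prop
  | coord _ => True
  | line _ _ => False

/-- The direction of the line which is the solution set of a row. -/
def dir {A : Type*} [CommRing A] (ρ : V → Fin 2 → A) : Row V → Fin 2 → A
  -- The signs make `cross (dir ρ (coord i)) z = z i`, so both kinds of rows read `cross (dir ρ R) z
  -- = value ρ t R`.
  | coord 0 => ![0, -1]
  | coord 1 => ![1, 0]
  | line a b => ρ b - ρ a

/-- The right-hand side of a row, the prescribed coordinate being `t`. -/
def value {A : Type*} [CommRing A] (ρ : V → Fin 2 → A) (t : A) : Row V → A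
  | coord _ => t
  | line a b => cross (ρ b - ρ a) (ρ a)

theorem map_dir {A B : Type*} [CommRing A] [CommRing B] (φ : A →+* B) (ρ : V → Fin 2 → A)
    (R : Row V) (i : Fin 2) : φ (dir ρ R i) = dir (fun v i => φ (ρ v i)) R i := by
  rcases R with j | ⟨a, b⟩
  · fin_cases j <;> fin_cases i <;> simp [dir]
  · simp [dir]

end Row

open Row

/-- Prescribing a coordinate in which the direction `u` does not vanish is independent of lying on a
line with direction `u`. -/
theorem exists_cross_coord_ne_zero {V K : Type*} [Field K] (ρ : V → Fin 2 → K) {u : Fin 2 → K}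
    (hu : u ≠ 0) : ∃ i, cross (dir ρ (coord i)) u ≠ 0 := by
  obtain ⟨i, hi⟩ := Function.ne_iff.mp hu
  refine ⟨i, ?_⟩
  fin_cases i <;> simpa [cross, dir] using hi

variable {V : Type*} [Fintype V] [DecidableEq V] {T : ConstrainedTriangulation V}

/-- A choice of two independent equations for each vertex except `r`, including one for each
relevant constraint. The vertices `a C`, `b C` are the first two of the constraint `C`. -/
structure RowSystem (T : ConstrainedTriangulation V) (L : LinearOrder V) (a b : Finset V → V)
    {K : Type*} [Field K] (ρ : V → Fin 2 → K) (R : V → Fin 2 → Row V) : Prop where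
  independent : ∀ v, v ≠ T.r → cross (dir ρ (R v 0)) (dir ρ (R v 1)) ≠ 0
  line : ∀ v k c d, R v k = line c d → v ≠ T.r →
    L.lt c v ∧ L.lt d v ∧ ∃ C ∈ T.constraints, c ∈ C ∧ d ∈ C ∧ v ∈ C
  relevant : ∀ v, ∀ C ∈ T.constraints, IsRelevant L C v → v ≠ T.r ∧ ∃ k, R v k = Row.line (a C) (b C)
  ne_of_isCoord : ∀ v k, (R v k).IsCoord → v ≠ T.r
  card_isCoord : ∑ v, T.α L v = Nat.card {x : V × Fin 2 // (R x.1 x.2).IsCoord}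

/-- The first two elements of all constraints. -/
structure FirstTwo (T : ConstrainedTriangulation V) (L : LinearOrder V) (a b : Finset V → V) :
    Prop where
  mem_a : ∀ C ∈ T.constraints, a C ∈ C
  mem_b : ∀ C ∈ T.constraints, b C ∈ C
  ne : ∀ C ∈ T.constraints, a C ≠ b C
  lt : ∀ C ∈ T.constraints, ∀ v, IsRelevant L C v → v ∈ C ∧ L.lt (a C) v ∧ L.lt (b C) v
  eq_or_relevant : ∀ C ∈ T.constraints, ∀ v ∈ C, v = a C ∨ v = b C ∨ IsRelevant L C v

theorem exists_firstTwo (T : ConstrainedTriangulation V) (L : LinearOrder V) :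
    ∃ a b, T.FirstTwo L a b := by
  have : ∀ C : Finset V, ∃ ab : V × V, C ∈ T.constraints → ab.1 ∈ C ∧ ab.2 ∈ C ∧ ab.1 ≠ ab.2 ∧
      (∀ v ∈ C, v = ab.1 ∨ v = ab.2 ∨ (L.lt ab.1 v ∧ L.lt ab.2 v)) ∧
      ∀ v, IsRelevant L C v ↔ v ∈ C ∧ v ≠ ab.1 ∧ v ≠ ab.2 := fun C => by
    by_cases hC : C ∈ T.constraints
    · obtain ⟨a, ha, b, hb, h⟩ := exists_first_two L (T.three_le_card hC)
      exact ⟨(a, b), fun _ => ⟨ha, hb, h⟩⟩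
    · exact ⟨(T.p, T.p), fun h => absurd h hC⟩
  choose ab h using this
  refine ⟨fun C => (ab C).1, fun C => (ab C).2, fun C hC => (h C hC).1, fun C hC => (h C hC).2.1,
    fun C hC => (h C hC).2.2.1, fun C hC v hv => ?_, fun C hC v hv => ?_⟩
  · obtain ⟨-, -, -, hlt, hrel⟩ := h C hC
    obtain ⟨hvC, hva, hvb⟩ := (hrel v).mp hv
    exact ⟨hvC, ((hlt v hvC).resolve_left hva).resolve_left hvb⟩
  · obtain ⟨-, -, -, -, hrel⟩ := h C hC
    rw [hrel]
    tauto

/-- The rows of a single vertex other than `r`. -/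
theorem exists_rows {L : LinearOrder V} (hL : T.IsDrawingOrder L) (hT : T.Drawable)
    {a b : Finset V → V} (hab : T.FirstTwo L a b) {K : Type*} [Field K] {ρ : V → Fin 2 → K}
    (hρ : T.GeneralPosition ρ) {v : V} (hv : v ≠ T.r) :
    ∃ R : Fin 2 → Row V, cross (dir ρ (R 0)) (dir ρ (R 1)) ≠ 0 ∧
      (∀ k c d, R k = line c d → L.lt c v ∧ L.lt d v ∧ ∃ C ∈ T.constraints, c ∈ C ∧ d ∈ C ∧ v ∈ C) ∧
      (∀ C ∈ T.constraints, IsRelevant L C v → ∃ k, R k = line (a C) (b C)) ∧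
      T.α L v = Nat.card {k // (R k).IsCoord} := by
  classical
  have hα := hL.alpha_eq hT v
  rw [if_neg hv] at hα
  have hα0 : 0 ≤ T.α L v := by
    by_cases hi : T.IsInterior v
    · exact (hL.2.2.2 v hi).2
    · have : v = T.p ∨ v = T.q ∨ v = T.s := by
        simp only [IsInterior] at hi; tauto
      simp [α, this]
  have hne : ∀ C ∈ T.constraints, ρ (b C) - ρ (a C) ≠ 0 := fun C hC =>
    sub_ne_zero.mpr (hρ.injective.ne (hab.ne C hC).symm)
  have hmem : ∀ C, C ∈ (T.constraints.filter fun C => IsRelevant L C v) ↔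
      C ∈ T.constraints ∧ IsRelevant L C v := fun C => Finset.mem_filter
  have hline : ∀ C ∈ T.constraints, IsRelevant L C v → L.lt (a C) v ∧ L.lt (b C) v ∧
      ∃ C' ∈ T.constraints, a C ∈ C' ∧ b C ∈ C' ∧ v ∈ C' := fun C hC hCv =>
    ⟨(hab.lt C hC v hCv).2.1, (hab.lt C hC v hCv).2.2, C, hC, hab.mem_a C hC, hab.mem_b C hC, hCv.1⟩
  -- This is where `0 ≤ α` enters: at most two constraints are relevant, and coordinate rows make up
  -- the difference to two.
  have hcard : (T.constraints.filter fun C => IsRelevant L C v).card ≤ 2 := by omega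
  rw [hα]
  generalize (T.constraints.filter fun C => IsRelevant L C v) = F at hmem hcard
  interval_cases hF : F.card
  · rw [Finset.card_eq_zero] at hF
    subst hF
    refine ⟨fun k => coord k, by simp [dir, cross], by simp, fun C hC hCv => ?_, ?_⟩
    · simpa using (hmem C).mpr ⟨hC, hCv⟩
    · simp [IsCoord]
  · obtain ⟨C, rfl⟩ := Finset.card_eq_one.mp hF
    obtain ⟨hC, hCv⟩ := (hmem C).mp (by simp)
    obtain ⟨i, hi⟩ := exists_cross_coord_ne_zero ρ (hne C hC)
    refine ⟨![coord i, line (a C) (b C)], hi, ?_, fun C' hC' hCv' => ⟨1, ?_⟩, ?_⟩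
    · intro k c d hk
      fin_cases k
      · simp at hk
      · simp only [Fin.mk_one, Matrix.cons_val_one, Matrix.cons_val_fin_one, line.injEq] at hk
        obtain ⟨rfl, rfl⟩ := hk
        exact hline C hC hCv
    · have : C' = C := by simpa using (hmem C').mpr ⟨hC', hCv'⟩
      simp [this]
    · have : Nat.card {k // (![coord i, line (a C) (b C)] k : Row V).IsCoord} = 1 := by
        refine Nat.card_eq_one_iff_exists.mpr ⟨⟨0, trivial⟩, fun ⟨k, hk⟩ => Subtype.ext ?_⟩
        fin_cases k
        · rfl
        · exact hk.elim
      rw [this]; simp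
  · obtain ⟨C, C', hCC', rfl⟩ := Finset.card_eq_two.mp hF
    obtain ⟨hC, hCv⟩ := (hmem C).mp (by simp)
    obtain ⟨hC', hCv'⟩ := (hmem C').mp (by simp)
    refine ⟨![line (a C) (b C), line (a C') (b C')], ?_, ?_, fun C₁ hC₁ hCv₁ => ?_, ?_⟩
    -- Both constraints contain `v`, so their lines are not parallel.
    · exact hρ.transversal C hC C' hC' hCC' ⟨v, Finset.mem_inter.mpr ⟨hCv.1, hCv'.1⟩⟩
        _ (hab.mem_a C hC) _ (hab.mem_b C hC) (hab.ne C hC)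
        _ (hab.mem_a C' hC') _ (hab.mem_b C' hC') (hab.ne C' hC')
    · intro k c d hk
      fin_cases k
      · simp only [Fin.zero_eta, Matrix.cons_val_zero, line.injEq] at hk
        obtain ⟨rfl, rfl⟩ := hk
        exact hline C hC hCv
      · simp only [Fin.mk_one, Matrix.cons_val_one, Matrix.cons_val_fin_one, line.injEq] at hk
        obtain ⟨rfl, rfl⟩ := hk
        exact hline C' hC' hCv'
    · have : C₁ = C ∨ C₁ = C' := by simpa using (hmem C₁).mpr ⟨hC₁, hCv₁⟩
      rcases this with rfl | rfl
      · exact ⟨0, by simp⟩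
      · exact ⟨1, by simp⟩
    · have : IsEmpty {k // (![line (a C) (b C), line (a C') (b C')] k : Row V).IsCoord} := by
        refine ⟨fun ⟨k, hk⟩ => ?_⟩
        fin_cases k <;> simp [IsCoord] at hk
      simp

theorem exists_rowSystem {L : LinearOrder V} (hL : T.IsDrawingOrder L) (hT : T.Drawable)
    {a b : Finset V → V} (hab : T.FirstTwo L a b) {K : Type*} [Field K] {ρ : V → Fin 2 → K}
    (hρ : T.GeneralPosition ρ) : ∃ R, T.RowSystem L a b ρ R := by
  classical
  have : ∀ v, ∃ R : Fin 2 → Row V, (v ≠ T.r → cross (dir ρ (R 0)) (dir ρ (R 1)) ≠ 0) ∧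
      (∀ k c d, R k = line c d → v ≠ T.r →
        L.lt c v ∧ L.lt d v ∧ ∃ C ∈ T.constraints, c ∈ C ∧ d ∈ C ∧ v ∈ C) ∧
      (∀ C ∈ T.constraints, IsRelevant L C v → v ≠ T.r ∧ ∃ k, R k = line (a C) (b C)) ∧
      (∀ k, (R k).IsCoord → v ≠ T.r) ∧
      T.α L v = Nat.card {k // (R k).IsCoord} := by
    intro v
    by_cases hv : v = T.r
    · have hrel : ∀ C ∈ T.constraints, ¬ IsRelevant L C v := fun C hC h =>
        (hL.isInterior hT hC h).2.2.1 hv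
      -- The rows of `r` are placeholders. They are not coordinate rows, in agreement with `α r =
      -- 0`.
      refine ⟨fun _ => line v v, fun h => absurd hv h, fun _ _ _ _ h => absurd hv h,
        fun C hC h => absurd h (hrel C hC), fun _ h => h.elim, ?_⟩
      rw [hL.alpha_eq hT, if_pos hv, Finset.filter_false_of_mem hrel]
      simp [IsCoord]
    · obtain ⟨R, h1, h2, h3, h4⟩ := exists_rows hL hT hab hρ hv
      exact ⟨R, fun _ => h1, fun k c d hk _ => h2 k c d hk, fun C hC h => ⟨hv, h3 C hC h⟩, fun _ _ => hv, h4⟩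
  choose R h1 h2 h3 h4 h5 using this
  refine ⟨R, h1, h2, h3, h4, ?_⟩
  rw [Finset.sum_congr rfl fun v _ => h5 v, ← Nat.cast_sum, ← Nat.card_sigma]
  congr 1
  exact Nat.card_congr ⟨fun x => ⟨(x.1, x.2.1), x.2.2⟩, fun x => ⟨x.1.1, x.1.2, x.2⟩,
    fun _ => rfl, fun _ => rfl⟩

theorem IsDrawingOrder.corners_lt {L : LinearOrder V} (hL : T.IsDrawingOrder L) :
    L.lt T.p T.r ∧ L.lt T.q T.r ∧ L.lt T.s T.r := by
  let := L
  have hnd := T.corners_nodup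
  simp only [List.nodup_cons, List.mem_cons, List.not_mem_nil, or_false, not_or] at hnd
  have hsr : T.s < T.r := lt_of_le_of_ne hL.2.2.1 (Ne.symm hnd.2.2.1)
  have hqr : T.q < T.r := lt_of_le_of_lt hL.2.1 hsr
  exact ⟨lt_of_le_of_lt hL.1 hqr, hqr, hsr⟩

/-- Upper bound: the prescribed coordinates generate the field generated by a placement. -/
theorem RowSystem.mem_adjoin {L : LinearOrder V} (hL : T.IsDrawingOrder L)
    {a b : Finset V → V} {𝕜 K : Type*} [Field 𝕜] [Field K] [Algebra 𝕜 K] {ρ : V → Fin 2 → K}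
    (hρ : T.GeneralPosition ρ) {R : V → Fin 2 → Row V} (hR : T.RowSystem L a b ρ R) (v : V)
    (i : Fin 2) :
    ρ v i ∈ IntermediateField.adjoin 𝕜 (Set.range
      fun x : {x : V × Fin 2 // (R x.1 x.2).IsCoord} => cross (dir ρ (R x.1.1 x.1.2)) (ρ x.1.1)) := by
  set F := IntermediateField.adjoin 𝕜 (Set.range
      fun x : {x : V × Fin 2 // (R x.1 x.2).IsCoord} => cross (dir ρ (R x.1.1 x.1.2)) (ρ x.1.1))
  have hcross : ∀ u w : Fin 2 → K, (∀ i, u i ∈ F) → (∀ i, w i ∈ F) → cross u w ∈ F :=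
    fun u w hu hw => F.sub_mem (F.mul_mem (hu _) (hw _)) (F.mul_mem (hu _) (hw _))
  obtain ⟨hpr, hqr, hsr⟩ := hL.corners_lt
  let := L
  induction v using WellFoundedLT.induction generalizing i with
  | ind v ih =>
  by_cases hv : v = T.r
  · subst hv
    have : ρ T.r = ρ T.q + ρ T.s - ρ T.p := by rw [← hρ.parallelogram]; abel
    rw [this]
    exact F.sub_mem (F.add_mem (ih _ hqr i) (ih _ hsr i)) (ih _ hpr i)
  -- The right-hand side of a coordinate row is one of the generators; a line row involves only
  -- earlier vertices, covered by the induction.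
  have hrow : ∀ k, (∀ i, dir ρ (R v k) i ∈ F) ∧ cross (dir ρ (R v k)) (ρ v) ∈ F := by
    intro k
    rcases hk : R v k with j | ⟨c, d⟩
    · constructor
      · intro i
        fin_cases j <;> fin_cases i <;> simp [dir, F.zero_mem, F.one_mem, F.neg_mem]
      · rw [← hk]
        exact IntermediateField.subset_adjoin 𝕜 _ ⟨⟨(v, k), by rw [hk]; trivial⟩, rfl⟩
    · obtain ⟨hc, hd, C, hC, hcC, hdC, hvC⟩ := hR.line v k c d hk hv
      have hdir : ∀ i, (ρ d - ρ c) i ∈ F := fun i => F.sub_mem (ih d hd i) (ih c hc i)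
      refine ⟨hdir, ?_⟩
      have : cross (dir ρ (Row.line c d)) (ρ v) = cross (ρ d - ρ c) (ρ c) := by
        have := hρ.collinear C hC c hcC d hdC v hvC
        rw [← sub_eq_zero, ← this]
        simp [dir, cross]; ring
      rw [this]
      exact hcross _ _ hdir (ih c hc)
  rw [eq_of_cross_eq (z := ρ v) (hR.independent v hv) i]
  exact F.div_mem (F.sub_mem (F.mul_mem ((hrow 1).1 i) (hrow 0).2)
    (F.mul_mem ((hrow 0).1 i) (hrow 1).2)) (hcross _ _ (hrow 0).1 (hrow 1).1)

end ConstrainedTriangulation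

/-! ### Solving the rows near a generic drawing -/

namespace ConstrainedTriangulation

open Row Filter Topology

variable {V : Type*} [Fintype V] [DecidableEq V] {T : ConstrainedTriangulation V}

/-- The solution of two independent rows. -/
def rowSolve {V K : Type*} [Field K] (ρ : V → Fin 2 → K) (R : Fin 2 → Row V) (t : Fin 2 → K) :
    Fin 2 → K := fun i =>
  (dir ρ (R 1) i * value ρ (t 0) (R 0) - dir ρ (R 0) i * value ρ (t 1) (R 1)) /
    cross (dir ρ (R 0)) (dir ρ (R 1))

theorem cross_rowSolve {V K : Type*} [Field K] {ρ : V → Fin 2 → K} {R : Fin 2 → Row V}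
    (t : Fin 2 → K) (h : cross (dir ρ (R 0)) (dir ρ (R 1)) ≠ 0) (k : Fin 2) :
    cross (dir ρ (R k)) (rowSolve ρ R t) = value ρ (t k) (R k) := by
  fin_cases k
  · exact cross_cramer_left h _ _
  · exact cross_cramer_right h _ _

theorem dir_congr {V K : Type*} [CommRing K] {ρ ρ' : V → Fin 2 → K} {R : Row V}
    (h : ∀ c d, R = line c d → ρ c = ρ' c ∧ ρ d = ρ' d) : dir ρ R = dir ρ' R := by
  rcases R with j | ⟨c, d⟩
  · fin_cases j <;> rfl
  · simp [dir, (h c d rfl).1, (h c d rfl).2]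

theorem value_congr {V K : Type*} [CommRing K] {ρ ρ' : V → Fin 2 → K} {R : Row V} (t : K)
    (h : ∀ c d, R = line c d → ρ c = ρ' c ∧ ρ d = ρ' d) : value ρ t R = value ρ' t R := by
  rcases R with j | ⟨c, d⟩
  · rfl
  · simp [value, (h c d rfl).1, (h c d rfl).2]

theorem rowSolve_congr {V K : Type*} [Field K] {ρ ρ' : V → Fin 2 → K} {R : Fin 2 → Row V}
    (t : Fin 2 → K) (h : ∀ k c d, R k = line c d → ρ c = ρ' c ∧ ρ d = ρ' d) :
    rowSolve ρ R t = rowSolve ρ' R t := by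
  funext i
  simp only [rowSolve, dir_congr (h 0), dir_congr (h 1), value_congr _ (h 0), value_congr _ (h 1)]

/-- The rows can be solved one vertex at a time, for arbitrary values of the coordinates. -/
theorem RowSystem.exists_solution {L : LinearOrder V} (hL : T.IsDrawingOrder L)
    {a b : Finset V → V} {K : Type*} [Field K] {ρ : V → Fin 2 → K}
    {R : V → Fin 2 → Row V} (hR : T.RowSystem L a b ρ R) (t : V × Fin 2 → K) :
    ∃ F : V → Fin 2 → K, F T.r = F T.q + F T.s - F T.p ∧
      ∀ v, v ≠ T.r → F v = rowSolve F (R v) (fun k => t (v, k)) := by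
  classical
  let := L
  -- Earlier positions are extended by zero to all vertices so that `rowSolve` can be applied; the
  -- rows of `v` never read the extension.
  let step : (v : V) → ((w : V) → w < v → Fin 2 → K) → Fin 2 → K := fun v prev =>
    let G : V → Fin 2 → K := fun w => if h : w < v then prev w h else 0
    if v = T.r then G T.q + G T.s - G T.p else rowSolve G (R v) (fun k => t (v, k))
  have wf : WellFounded (fun v w : V => v < w) := wellFounded_lt
  have hfix : ∀ v, wf.fix step v = step v fun w _ => wf.fix step w := fun v => wf.fix_eq step v
  obtain ⟨hp, hq, hs⟩ := hL.corners_lt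
  refine ⟨wf.fix step, ?_, fun v hv => ?_⟩
  · rw [hfix T.r]
    have hp : T.p < T.r := hp
    have hq : T.q < T.r := hq
    have hs : T.s < T.r := hs
    simp only [step, if_true, dif_pos hp, dif_pos hq, dif_pos hs]
  · rw [hfix v]
    simp only [step, if_neg hv]
    refine rowSolve_congr _ fun k c d hk => ?_
    obtain ⟨hc, hd, -⟩ := hR.line v k c d hk hv
    have hc : c < v := hc
    have hd : d < v := hd
    exact ⟨dif_pos hc, dif_pos hd⟩

/-- For a coordinate row this is a tautology; for a line row it is the collinearity of a constraint.
-/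
theorem GeneralPosition.cross_dir_eq_value {K : Type*} [Field K] {ρ : V → Fin 2 → K}
    (hρ : T.GeneralPosition ρ) {L : LinearOrder V} {a b : Finset V → V}
    {R : V → Fin 2 → Row V} (hR : T.RowSystem L a b ρ R) {v : V} (hv : v ≠ T.r) (k : Fin 2) :
    cross (dir ρ (R v k)) (ρ v) = value ρ (cross (dir ρ (R v k)) (ρ v)) (R v k) := by
  rcases hk : R v k with j | ⟨c, d⟩
  · rfl
  · obtain ⟨-, -, C, hC, hcC, hdC, hvC⟩ := hR.line v k c d hk hv
    have := hρ.collinear C hC c hcC d hdC v hvC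
    rw [← sub_eq_zero, ← this]
    simp [dir, value, cross]; ring

/-- A solution of the rows is in general position if it is nondegenerate. -/
theorem RowSystem.generalPosition {L : LinearOrder V} {a b : Finset V → V}
    (hab : T.FirstTwo L a b) {K : Type*} [Field K] {ρ : V → Fin 2 → K}
    {R : V → Fin 2 → Row V} (hR : T.RowSystem L a b ρ R) {F : V → Fin 2 → K}
    {t : V × Fin 2 → K} (hr : F T.r = F T.q + F T.s - F T.p)
    (hF : ∀ v, v ≠ T.r → F v = rowSolve F (R v) (fun k => t (v, k)))
    (hind : ∀ v, v ≠ T.r → cross (dir F (R v 0)) (dir F (R v 1)) ≠ 0)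
    (hinj : Function.Injective F)
    (htr : ∀ C ∈ T.constraints, ∀ C' ∈ T.constraints, C ≠ C' → (C ∩ C').Nonempty →
      ∀ a ∈ C, ∀ b ∈ C, a ≠ b → ∀ a' ∈ C', ∀ b' ∈ C', a' ≠ b' →
        cross (F b - F a) (F b' - F a') ≠ 0) : T.GeneralPosition F := by
  refine ⟨fun C hC x hx y hy z hz => ?_, by rw [hr]; abel, hinj, htr⟩
  -- Every vertex of `C` lies on the line through its first two: a later one has this line among its
  -- rows.
  have key : ∀ v ∈ C, cross (F (b C) - F (a C)) (F v - F (a C)) = 0 := by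
    intro v hv
    rcases hab.eq_or_relevant C hC v hv with rfl | rfl | hrel
    · simp [cross]
    · simp [cross]; ring
    · obtain ⟨hvr, k, hk⟩ := hR.relevant v C hC hrel
      have := cross_rowSolve (fun k => t (v, k)) (hind v hvr) k
      rw [← hF v hvr, hk] at this
      simp only [dir, value] at this
      rw [← sub_eq_zero] at this
      rw [← this]
      simp [cross]; ring
  have hsub : ∀ v ∈ C, cross (F (b C) - F (a C)) (F v - F x) = 0 := fun v hv => by
    have h := congrArg₂ (· - ·) (key v hv) (key x hx)
    simp only [sub_zero] at h
    rw [← h]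
    simp [cross]; ring
  exact cross_eq_zero_of_parallel (sub_ne_zero.mpr (hinj.ne (hab.ne C hC).symm)) (hsub y hy)
    (hsub z hz)

theorem continuousAt_dir {X : Type*} [TopologicalSpace X] {x : X} {V : Type*}
    {F : X → V → Fin 2 → ℂ} {R : Row V}
    (h : ∀ c d, R = line c d → (∀ i, ContinuousAt (fun t => F t c i) x) ∧
      ∀ i, ContinuousAt (fun t => F t d i) x) (i : Fin 2) :
    ContinuousAt (fun t => dir (F t) R i) x := by
  rcases R with j | ⟨c, d⟩
  · fin_cases j <;> exact continuousAt_const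
  · exact ((h c d rfl).2 i).sub ((h c d rfl).1 i)

theorem continuousAt_cross {X : Type*} [TopologicalSpace X] {x : X} {u w : X → Fin 2 → ℂ}
    (hu : ∀ i, ContinuousAt (fun t => u t i) x) (hw : ∀ i, ContinuousAt (fun t => w t i) x) :
    ContinuousAt (fun t => cross (u t) (w t)) x :=
  ((hu 0).mul (hw 1)).sub ((hu 1).mul (hw 0))

theorem continuousAt_value {X : Type*} [TopologicalSpace X] {x : X} {V : Type*}
    {F : X → V → Fin 2 → ℂ} {R : Row V} {s : X → ℂ} (hs : ContinuousAt s x)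
    (h : ∀ c d, R = line c d → (∀ i, ContinuousAt (fun t => F t c i) x) ∧
      ∀ i, ContinuousAt (fun t => F t d i) x) :
    ContinuousAt (fun t => value (F t) (s t) R) x := by
  rcases R with j | ⟨c, d⟩
  · exact hs
  · exact continuousAt_cross (fun i => ((h c d rfl).2 i).sub ((h c d rfl).1 i)) (h c d rfl).1

theorem eventually_cross_ne_zero {V : Type*} {ρ : V → Fin 2 → ℂ} {a b c d : V}
    (h : cross (ρ b - ρ a) (ρ d - ρ c) ≠ 0) :
    ∀ᶠ F in 𝓝 ρ, cross (F b - F a) (F d - F c) ≠ 0 := by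
  have hcoord : ∀ v i, ContinuousAt (fun F : V → Fin 2 → ℂ => F v i) ρ :=
    fun v i => (continuous_apply_apply v i).continuousAt
  exact (continuousAt_cross (u := fun F : V → Fin 2 → ℂ => F b - F a)
    (w := fun F => F d - F c)
    (fun i => (hcoord b i).sub (hcoord a i))
    (fun i => (hcoord d i).sub (hcoord c i))).eventually_ne h

theorem NondegenerateTriangles.eventually {ρ : V → Fin 2 → ℂ} (hρ : T.NondegenerateTriangles ρ) :
    ∀ᶠ F in 𝓝 ρ, T.NondegenerateTriangles F := by
  obtain ⟨h1, h2, h3, h4, hliv⟩ := hρ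
  have h5 : ∀ᶠ F in 𝓝 ρ, ∀ x y z, x ≠ y → y ≠ z → x ≠ z → T.IsLiving {x, y, z} →
      cross (F y - F x) (F z - F x) ≠ 0 := by
    simp only [eventually_all]
    exact fun x y z hxy hyz hxz h => eventually_cross_ne_zero (hliv x y z hxy hyz hxz h)
  filter_upwards [eventually_cross_ne_zero h1, eventually_cross_ne_zero h2,
    eventually_cross_ne_zero h3, eventually_cross_ne_zero h4, h5] with F h1 h2 h3 h4 h5
  exact ⟨h1, h2, h3, h4, h5⟩

omit [DecidableEq V] in
theorem eventually_injective {ρ : V → Fin 2 → ℂ} (hρ : Function.Injective ρ) :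
    ∀ᶠ F in 𝓝 ρ, Function.Injective F := by
  have : ∀ᶠ F in 𝓝 ρ, ∀ v w : V, v ≠ w → F v ≠ F w := by
    simp only [eventually_all]
    exact fun v w hvw => (((continuous_apply v).sub (continuous_apply w)).continuousAt.eventually_ne
      (sub_ne_zero.mpr (hρ.ne hvw))).mono fun F hF => sub_ne_zero.mp hF
  exact this.mono fun F hF v w h => by_contra fun hvw => hF v w hvw h

theorem GeneralPosition.eventually_transversal {ρ : V → Fin 2 → ℂ} (hρ : T.GeneralPosition ρ) :
    ∀ᶠ F in 𝓝 ρ, ∀ C ∈ T.constraints, ∀ C' ∈ T.constraints, C ≠ C' → (C ∩ C').Nonempty →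
      ∀ a ∈ C, ∀ b ∈ C, a ≠ b → ∀ a' ∈ C', ∀ b' ∈ C', a' ≠ b' →
        cross (F b - F a) (F b' - F a') ≠ 0 := by
  refine (eventually_all_finset _).mpr fun C hC => (eventually_all_finset _).mpr fun C' hC' => ?_
  refine eventually_all.mpr fun hne => eventually_all.mpr fun hint => ?_
  refine (eventually_all_finset _).mpr fun a ha => (eventually_all_finset _).mpr fun b hb => ?_
  refine eventually_all.mpr fun hab => ?_
  refine (eventually_all_finset _).mpr fun a' ha' => (eventually_all_finset _).mpr fun b' hb' => ?_
  exact eventually_all.mpr fun hab' =>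
    eventually_cross_ne_zero (hρ.transversal C hC C' hC' hne hint a ha b hb hab a' ha' b' hb' hab')

theorem RowSystem.eventually_independent {L : LinearOrder V} {a b : Finset V → V}
    {ρ : V → Fin 2 → ℂ} {R : V → Fin 2 → Row V} (hR : T.RowSystem L a b ρ R) :
    ∀ᶠ F in 𝓝 ρ, ∀ v, v ≠ T.r → cross (dir F (R v 0)) (dir F (R v 1)) ≠ 0 := by
  have hcoord : ∀ v i, ContinuousAt (fun F : V → Fin 2 → ℂ => F v i) ρ :=
    fun v i => (continuous_apply_apply v i).continuousAt
  have hdir : ∀ R i, ContinuousAt (fun F : V → Fin 2 → ℂ => dir F R i) ρ := fun R i =>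
    continuousAt_dir (fun c d _ => ⟨hcoord c, hcoord d⟩) i
  simp only [eventually_all]
  exact fun v hv => (continuousAt_cross (hdir _) (hdir _)).eventually_ne (hR.independent v hv)

/-- Near a generic drawing there are generic drawings with arbitrary values of the prescribed
coordinates. -/
theorem RowSystem.eventually_isGenericDrawing {L : LinearOrder V} (hL : T.IsDrawingOrder L)
    {a b : Finset V → V} (hab : T.FirstTwo L a b) {ρ : V → Fin 2 → ℂ} (hρ : T.IsGenericDrawing ρ)
    {R : V → Fin 2 → Row V} (hR : T.RowSystem L a b ρ R) :
    ∃ t₀ : V × Fin 2 → ℂ, ∀ᶠ t in 𝓝 t₀, ∃ F, T.IsGenericDrawing F ∧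
      ∀ v k, (R v k).IsCoord → cross (dir F (R v k)) (F v) = t (v, k) := by
  -- `F t` exists for every `t`, with division by zero where the rows become dependent; only `t`
  -- near `t₀` matter.
  choose F hFr hF using hR.exists_solution hL
  have hG := hρ.generalPosition
  let t₀ : V × Fin 2 → ℂ := fun x => cross (dir ρ (R x.1 x.2)) (ρ x.1)
  obtain ⟨hp, hq, hs⟩ := hL.corners_lt
  let := L
  -- The parameters `t₀` are read off from `ρ`, and the rows determine the vertices one by one, so
  -- they recover `ρ`.
  have h0 : F t₀ = ρ := by
    funext v
    induction v using WellFoundedLT.induction with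
    | ind v ih =>
    by_cases hv : v = T.r
    · subst hv
      rw [hFr, ih _ hp, ih _ hq, ih _ hs, ← hG.parallelogram]
      abel
    · have hc : rowSolve (F t₀) (R v) (fun k => t₀ (v, k)) = rowSolve ρ (R v) fun k => t₀ (v, k) :=
        rowSolve_congr _ fun k c d hk =>
          have h := hR.line v k c d hk hv
          ⟨ih c h.1, ih d h.2.1⟩
      rw [hF t₀ v hv, hc]
      funext i
      rw [eq_of_cross_eq (z := ρ v) (hR.independent v hv) i, hG.cross_dir_eq_value hR hv 0,
        hG.cross_dir_eq_value hR hv 1]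
      rfl
  have hcont : ∀ v i, ContinuousAt (fun t => F t v i) t₀ := by
    intro v
    induction v using WellFoundedLT.induction with
    | ind v ih =>
    intro i
    by_cases hv : v = T.r
    · subst hv
      simp only [hFr]
      exact ((ih _ hq i).add (ih _ hs i)).sub (ih _ hp i)
    · have href : ∀ k c d, R v k = Row.line c d → (∀ i, ContinuousAt (fun t => F t c i) t₀) ∧
          ∀ i, ContinuousAt (fun t => F t d i) t₀ := fun k c d hk =>
        have h := hR.line v k c d hk hv
        ⟨ih c h.1, ih d h.2.1⟩
      have heq : (fun t => F t v i) = fun t => rowSolve (F t) (R v) (fun k => t (v, k)) i := by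
        funext t
        exact congrFun (hF t v hv) i
      rw [heq]
      refine ContinuousAt.div (((continuousAt_dir (href 1) i).mul (continuousAt_value ?_ (href 0))).sub
        ((continuousAt_dir (href 0) i).mul (continuousAt_value ?_ (href 1))))
        (continuousAt_cross (continuousAt_dir (href 0)) (continuousAt_dir (href 1))) ?_
      · exact (continuous_apply (v, 0)).continuousAt
      · exact (continuous_apply (v, 1)).continuousAt
      · rw [h0]; exact hR.independent v hv
  have hcontF : Tendsto F (𝓝 t₀) (𝓝 ρ) := by
    have : ContinuousAt F t₀ := continuousAt_pi.mpr fun v => continuousAt_pi.mpr fun i => hcont v i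
    rwa [ContinuousAt, h0] at this
  -- The nondegeneracy conditions are finitely many and open at `ρ`, so they pull back along `F` to
  -- a neighbourhood of `t₀`.
  refine ⟨t₀, (hcontF.eventually (hR.eventually_independent.and ((eventually_injective hG.injective).and
    (hG.eventually_transversal.and hρ.nondegenerateTriangles.eventually)))).mono ?_⟩
  rintro t ⟨hind, hinj, htr, hN⟩
  refine ⟨F t, (hR.generalPosition hab (hFr t) (hF t) hind hinj htr).isGenericDrawing hN,
    fun v k hk => ?_⟩
  have hv := hR.ne_of_isCoord v k hk
  have := cross_rowSolve (fun k => t (v, k)) (hind v hv) k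
  rw [← hF t v hv] at this
  rw [this]
  rcases h : R v k with j | ⟨c, d⟩
  · rfl
  · rw [h] at hk; exact hk.elim

end ConstrainedTriangulation

/-! ### The ideal of the variety and its dimension -/

open Filter Topology in
-- A neighbourhood contains a product of balls, and a polynomial that vanishes on a product of
-- infinite sets is zero.
theorem MvPolynomial.eq_zero_of_eventually {ι : Type*} [Fintype ι] {f : MvPolynomial ι ℂ}
    {x : ι → ℂ} (h : ∀ᶠ t in 𝓝 x, MvPolynomial.eval t f = 0) : f = 0 := by
  obtain ⟨ε, hε, hball⟩ := Metric.eventually_nhds_iff_ball.mp h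
  refine MvPolynomial.funext_set (fun i => Metric.ball (x i) ε)
    (fun i => infinite_of_mem_nhds (x i) (Metric.ball_mem_nhds _ hε)) fun t ht => ?_
  rw [map_zero]
  exact hball t (by rwa [ball_pi _ hε])

namespace ConstrainedTriangulation

open Row Filter Topology

variable {V : Type*} [Fintype V] [DecidableEq V] {T : ConstrainedTriangulation V}

variable (T) in
/-- The ideal of the variety of drawings. -/
noncomputable def drawingIdeal : Ideal (MvPolynomial (V × Fin 2) ℂ) :=
  MvPolynomial.vanishingIdeal ℂ ((fun (ρ : V → Fin 2 → ℂ) (i : V × Fin 2) => ρ i.1 i.2) '' T.X)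

/-- Zero sets of polynomials are closed, so passing to the closure does not change the ideal. -/
theorem mem_drawingIdeal {f : MvPolynomial (V × Fin 2) ℂ} :
    f ∈ T.drawingIdeal ↔
      ∀ ρ : V → Fin 2 → ℂ, T.IsGenericDrawing ρ → MvPolynomial.aeval (fun i => ρ i.1 i.2) f = 0 := by
  constructor
  · intro h ρ hρ
    exact h _ ⟨ρ, subset_closure hρ, rfl⟩
  · rintro h _ ⟨ρ, hρ, rfl⟩
    have hcont : Continuous fun ρ : V → Fin 2 → ℂ =>
        MvPolynomial.eval (fun i : V × Fin 2 => ρ i.1 i.2) f :=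
      (MvPolynomial.continuous_eval f).comp
        (continuous_pi fun i => continuous_apply_apply i.1 i.2)
    have hclosed : IsClosed {ρ : V → Fin 2 → ℂ |
        MvPolynomial.eval (fun i : V × Fin 2 => ρ i.1 i.2) f = 0} :=
      isClosed_eq hcont continuous_const
    have hsub : {ρ | T.IsGenericDrawing ρ} ⊆ {ρ : V → Fin 2 → ℂ |
        MvPolynomial.eval (fun i : V × Fin 2 => ρ i.1 i.2) f = 0} := fun ρ hρ => h ρ hρ
    exact closure_minimal hsub hclosed hρ

theorem drawingIdeal_ne_top (hT : T.Drawable) : T.drawingIdeal ≠ ⊤ := by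
  obtain ⟨ρ, hρ⟩ := hT
  intro h
  have := mem_drawingIdeal.mp ((Ideal.eq_top_iff_one _).mp h) ρ hρ
  simp at this

/-- The coordinates of the universal placement. -/
noncomputable def universal (V : Type*) (v : V) (i : Fin 2) : MvPolynomial (V × Fin 2) ℂ :=
  MvPolynomial.X (v, i)

theorem aeval_cross_universal {V : Type*} (ρ : V → Fin 2 → ℂ) (a b c d : V) :
    MvPolynomial.aeval (fun i : V × Fin 2 => ρ i.1 i.2)
      (cross (universal V b - universal V a) (universal V d - universal V c)) =
      cross (ρ b - ρ a) (ρ d - ρ c) := by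
  simp [cross, universal]

/-- The generic point of a component of the variety of drawings is in general position. -/
theorem generalPosition_of_mem_minimalPrimes {K : Type*} [Field K]
    {P : Ideal (MvPolynomial (V × Fin 2) ℂ)} (hP : P ∈ T.drawingIdeal.minimalPrimes)
    (φ : MvPolynomial (V × Fin 2) ℂ →+* K) (hφ : ∀ f, φ f = 0 ↔ f ∈ P) :
    T.GeneralPosition fun v i => φ (universal V v i) := by
  have hcolon : T.drawingIdeal = Submodule.colon T.drawingIdeal {(1 : MvPolynomial (V × Fin 2) ℂ)} := by
    ext f
    simp [Submodule.mem_colon_singleton]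
  -- In a Noetherian ring a minimal prime over `I` has the form `(I : h)`. Here `I` is written as
  -- `(I : 1)` to fit the colon form of the lemma.
  obtain ⟨h, hh⟩ := Submodule.exists_eq_colon_of_mem_minimalPrimes (hcolon ▸ hP)
  have hmem : ∀ f, φ f = 0 ↔ f * h ∈ T.drawingIdeal := fun f => by
    rw [hφ, hh, Submodule.mem_colon_singleton, smul_eq_mul]
  have hh0 : h ∉ T.drawingIdeal := fun h0 => by
    have := (hmem 1).mpr (by simpa using h0)
    simp at this
  have hzero : ∀ f, (∀ ρ : V → Fin 2 → ℂ, T.IsGenericDrawing ρ →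
      MvPolynomial.aeval (fun i => ρ i.1 i.2) f = 0) → φ f = 0 := fun f hf =>
    (hφ f).mpr (hP.le (mem_drawingIdeal.mpr hf))
  -- If `f` and `g` lie in `P`, then `f * h` and `g * h` vanish at all generic drawings, while `h`
  -- is nonzero at one of them; there `f` and `g` both vanish. Two polynomials are needed for
  -- injectivity, where points differ in only one of two coordinates.
  have hnonzero : ∀ f g, φ f = 0 → φ g = 0 → ∃ ρ : V → Fin 2 → ℂ, T.IsGenericDrawing ρ ∧
      MvPolynomial.aeval (fun i => ρ i.1 i.2) f = 0 ∧
      MvPolynomial.aeval (fun i => ρ i.1 i.2) g = 0 := by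
    intro f g hf hg
    by_contra! hn
    refine hh0 (mem_drawingIdeal.mpr fun ρ hρ => ?_)
    have h1 := mem_drawingIdeal.mp ((hmem f).mp hf) ρ hρ
    have h2 := mem_drawingIdeal.mp ((hmem g).mp hg) ρ hρ
    rw [map_mul, mul_eq_zero] at h1 h2
    by_contra h0
    exact hn ρ hρ (h1.resolve_right h0) (h2.resolve_right h0)
  have hcross : ∀ a b c d : V, cross ((fun i => φ (universal V b i)) - fun i => φ (universal V a i))
      ((fun i => φ (universal V d i)) - fun i => φ (universal V c i)) =
      φ (cross (universal V b - universal V a) (universal V d - universal V c)) := fun a b c d => by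
    simp [cross]
  constructor
  · intro C hC a ha b hb c hc
    rw [hcross]
    refine hzero _ fun ρ hρ => ?_
    rw [aeval_cross_universal]
    exact hρ.generalPosition.collinear C hC a ha b hb c hc
  · funext i
    simp only [Pi.add_apply, ← map_add]
    rw [← sub_eq_zero, ← map_sub]
    refine hzero _ fun ρ hρ => ?_
    have := congrFun hρ.generalPosition.parallelogram i
    simp only [Pi.add_apply] at this
    simp [universal, this]
  · intro v w hvw
    have hi : ∀ i, φ (universal V v i - universal V w i) = 0 := fun i => by
      rw [map_sub, sub_eq_zero]; exact congrFun hvw i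
    obtain ⟨ρ, hρ, h0, h1⟩ := hnonzero _ _ (hi 0) (hi 1)
    refine hρ.generalPosition.injective (funext fun i => ?_)
    simp only [universal, map_sub, MvPolynomial.aeval_X, sub_eq_zero] at h0 h1
    fin_cases i
    exacts [h0, h1]
  · intro C hC C' hC' hne hint a ha b hb hab a' ha' b' hb' hab'
    rw [hcross]
    intro h0
    obtain ⟨ρ, hρ, h0, -⟩ := hnonzero _ _ h0 h0
    rw [aeval_cross_universal] at h0
    exact hρ.generalPosition.transversal C hC C' hC' hne hint a ha b hb hab a' ha' b' hb' hab' h0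

/-- Each component of the variety of drawings has dimension at most `∑ α`. -/
theorem trdeg_le_sum_alpha (hT : T.Drawable) {L : LinearOrder V} (hL : T.IsDrawingOrder L)
    {n : ℕ} (hn : ∑ v, T.α L v = n) {P : Ideal (MvPolynomial (V × Fin 2) ℂ)}
    (hP : P ∈ T.drawingIdeal.minimalPrimes) :
    Algebra.trdeg ℂ (MvPolynomial (V × Fin 2) ℂ ⧸ P) ≤ n := by
  classical
  have := hP.isPrime
  let A := MvPolynomial (V × Fin 2) ℂ ⧸ P
  let K := FractionRing A
  let f : A →ₐ[ℂ] K := IsScalarTower.toAlgHom ℂ A K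
  have hf : Function.Injective f := IsFractionRing.injective A K
  let φ : MvPolynomial (V × Fin 2) ℂ →+* K := (f : A →+* K).comp (Ideal.Quotient.mk P)
  have hφ : ∀ g, φ g = 0 ↔ g ∈ P := fun g => by
    rw [← Ideal.Quotient.eq_zero_iff_mem]
    exact map_eq_zero_iff f hf
  obtain ⟨a, b, hab⟩ := exists_firstTwo T L
  have hG := generalPosition_of_mem_minimalPrimes hP φ hφ
  -- The rows are chosen for the generic point of this component and may differ between components;
  -- their number of coordinate rows does not.
  obtain ⟨R, hR⟩ := exists_rowSystem hL hT hab hG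
  have hcard : n = Fintype.card {x : V × Fin 2 // (R x.1 x.2).IsCoord} := by
    have := hR.card_isCoord
    rw [hn, Nat.card_eq_fintype_card] at this
    exact_mod_cast this
  rw [hcard]
  refine trdeg_le_card_of_mem_adjoin f hf (fun x : {x : V × Fin 2 // (R x.1 x.2).IsCoord} =>
    cross (dir (fun v i => φ (universal V v i)) (R x.1.1 x.1.2))
      (fun i => φ (universal V x.1.1 i))) fun g => ?_
  obtain ⟨g, rfl⟩ := Ideal.Quotient.mk_surjective g
  induction g using MvPolynomial.induction_on with
  | C c =>
    exact IntermediateField.algebraMap_mem _ c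
  | add g h hg hh =>
    rw [map_add, map_add]
    exact add_mem hg hh
  | mul_X g x hg =>
    rw [map_mul, map_mul]
    exact mul_mem hg (hR.mem_adjoin (𝕜 := ℂ) hL hG x.1 x.2)

/-- The prescribed coordinates are algebraically independent on the variety of drawings. -/
theorem exists_comap_drawingIdeal_eq_bot (hT : T.Drawable) {L : LinearOrder V}
    (hL : T.IsDrawingOrder L) {n : ℕ} (hn : ∑ v, T.α L v = n) :
    ∃ ψ : MvPolynomial (Fin n) ℂ →ₐ[ℂ] MvPolynomial (V × Fin 2) ℂ, T.drawingIdeal.comap ψ = ⊥ := by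
  classical
  obtain ⟨ρ, hρ⟩ := id hT
  obtain ⟨a, b, hab⟩ := exists_firstTwo T L
  obtain ⟨R, hR⟩ := exists_rowSystem hL hT hab hρ.generalPosition
  obtain ⟨t₀, ht₀⟩ := hR.eventually_isGenericDrawing hL hab hρ
  have hcard : Fintype.card {x : V × Fin 2 // (R x.1 x.2).IsCoord} = n := by
    have := hR.card_isCoord
    rw [hn, Nat.card_eq_fintype_card] at this
    exact_mod_cast this.symm
  let e := Fintype.equivFinOfCardEq hcard
  let ι : Fin n → V × Fin 2 := fun k => (e.symm k).1
  have hι : Function.Injective ι := Subtype.val_injective.comp e.symm.injective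
  let y : Fin n → MvPolynomial (V × Fin 2) ℂ := fun k =>
    cross (dir (universal V) (R (ι k).1 (ι k).2)) (universal V (ι k).1)
  refine ⟨MvPolynomial.aeval y, (Submodule.eq_bot_iff _).mpr fun f hf => ?_⟩
  -- The relation is viewed as a polynomial in all parameters `t`, so that it can be tested on the
  -- open set of admissible `t`.
  refine MvPolynomial.rename_injective ι hι ?_
  rw [map_zero]
  refine MvPolynomial.eq_zero_of_eventually (ht₀.mono fun t ⟨F, hF, hFt⟩ => ?_)
  rw [← mem_drawingIdeal.mp hf F hF, MvPolynomial.eval_rename]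
  have hy : ∀ k, MvPolynomial.aeval (fun i : V × Fin 2 => F i.1 i.2) (y k) = t (ι k) := fun k => by
    rw [← hFt _ _ (e.symm k).2]
    have hu : ∀ v i, MvPolynomial.aeval (fun i : V × Fin 2 => F i.1 i.2) (universal V v i) = F v i :=
      fun v i => MvPolynomial.aeval_X _ _
    have h1 := map_cross (MvPolynomial.aeval (fun i : V × Fin 2 => F i.1 i.2)).toRingHom
      (dir (universal V) (R (ι k).1 (ι k).2)) (universal V (ι k).1)
    simp only [map_dir] at h1
    simp only [AlgHom.toRingHom_eq_coe, RingHom.coe_coe, hu] at h1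
    exact h1
  rw [← AlgHom.comp_apply, MvPolynomial.comp_aeval]
  simp only [hy]
  rfl

/-- The dimension of the variety of drawings is the number of degrees of freedom. -/
theorem dimX_eq_of_isDrawingOrder (hT : T.Drawable) {L : LinearOrder V} (hL : T.IsDrawingOrder L)
    {n : ℕ} (hn : ∑ v, T.α L v = n) : T.dimX = n := by
  obtain ⟨ψ, hψ⟩ := exists_comap_drawingIdeal_eq_bot hT hL hn
  have := ringKrullDim_quotient_eq T.drawingIdeal (drawingIdeal_ne_top hT) ψ hψ fun P hP => by
    simpa using trdeg_le_sum_alpha hT hL hn hP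
  rwa [Fintype.card_fin] at this

theorem IsDrawingOrder.sum_alpha_nonneg {L : LinearOrder V} (hL : T.IsDrawingOrder L) :
    0 ≤ ∑ v, T.α L v := by
  refine Finset.sum_nonneg fun v _ => ?_
  by_cases hv : T.IsInterior v
  · exact (hL.2.2.2 v hv).2
  · simp only [IsInterior] at hv
    simp only [α]
    split_ifs with h1 h2
    · norm_num
    · norm_num
    · tauto

end ConstrainedTriangulation

theorem mainTheorem9 {V : Type*} [Fintype V] [DecidableEq V]
    (T : ConstrainedTriangulation V) (hT : T.Drawable) :
    (∀ L L' : LinearOrder V, T.IsDrawingOrder L → T.IsDrawingOrder L' →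
      ∑ v, T.α L v = ∑ v, T.α L' v) ∧
    ∃ d : ℕ, T.dimX = (d : WithBot ℕ∞) ∧
      ∀ L : LinearOrder V, T.IsDrawingOrder L →
        ∑ v, T.α L v = (d : ℤ) ∧ (d : ℤ) = T.heuristicDim := by
  refine ⟨fun L L' hL hL' => (hL.sum_alpha hT).trans (hL'.sum_alpha hT).symm, ?_⟩
  -- The dimension is a natural number even if there is no drawing order, so it is obtained from
  -- Noether normalization.
  obtain ⟨d, -, -, -, hd⟩ := exists_noether_parameters ℂ T.drawingIdeal
    (ConstrainedTriangulation.drawingIdeal_ne_top hT)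
  have hd : T.dimX = d := hd
  refine ⟨d, hd, fun L hL => ?_⟩
  obtain ⟨n, hn⟩ := Int.eq_ofNat_of_zero_le hL.sum_alpha_nonneg
  have hnd : n = d := by
    have := (ConstrainedTriangulation.dimX_eq_of_isDrawingOrder hT hL hn).symm.trans hd
    exact_mod_cast this
  rw [← hL.sum_alpha hT, hn, hnd]
  exact ⟨rfl, rfl⟩
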